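/- **Definitions.** An instance of the $d$-dimensional generalized minimum Manhattan network problem (GMMN) is a collection $R$ of $n$ pairs $(t,t')$ of points (terminals) of $\mathbb{R}^d$. A rectilinear network is a finite collection of axis-parallel segments in $\mathbb{R}^d$; its length is the total length of its segments. A Manhattan path between $t$ and $t'$ is a path of axis-parallel segments from $t$ to $t'$ whose total length is $\sum_{i=1}^d |x_i(t)-x_i(t')|$. A rectilinear network is a feasible solution of $R$ if for every pair $(t,t')\in R$ it contains (as a point set) a Manhattan path between $t$ and $t'$; the goal is to find a feasible solution of minimum length. The instance $R$ is $d$-separated if there are values $s_1,\dots,s_d\in\mathbb{R}$ such that for every $(t,t')\in R$ and every $i\in\{1,\dots,d\}$ either $x_i(t)\le s_i\le x_i(t')$ or $x_i(t')\le s_i\le x_i(t)$, that is, if the bounding boxes of all pairs contain a common point. **Lemma.** For every fixed number $d$ of dimensions, $d$-separated GMMN admits an $O(\log n)$-approximation. That is, for every $d$ there are a function $\rho$ with $\rho(n)=O(\log n)$ as $n\to\infty$, a polynomial $P$, and an algorithm (a program of a real random access machine with indirect addressing, whose elementary operations, of unit cost each, are additions, subtractions and comparisons, with rational constants allowed) that,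 given any $d$-separated instance $R$ with $n\geq 0$ terminal pairs, halts after at most $P(n)$ steps and outputs a feasible solution of $R$ whose length is at most $\rho(n)$ times the length of every feasible solution of $R$. -/

import Mathlib

namespace GMMN

/-! ### Rectilinear networks and Manhattan paths -/

/-- Points of `d`-dimensional space, given by their coordinates. -/
abbrev Pt (d : ℕ) : Type := Fin d → ℝ

/-- The Manhattan distance of two points. -/
noncomputable def manhattanDist {d : ℕ} (x y : Pt d) : ℝ := ∑ i, |x i - y i|

/-- The segment between `x` and `y` is axis-parallel (or a single point): the two points differ in
at most one coordinate. -/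
def AxisParallel {d : ℕ} (x y : Pt d) : Prop :=
  ∀ i j, x i ≠ y i → x j ≠ y j → i = j

/-- A finite list of segments, each given by its two endpoints. -/
abbrev Network (d : ℕ) : Type := List (Pt d × Pt d)

/-- All segments of the network are axis-parallel. -/
def IsRectilinear {d : ℕ} (N : Network d) : Prop :=
  ∀ e ∈ N, AxisParallel e.1 e.2

/-- The set of points covered by a network. -/
def support {d : ℕ} (N : Network d) : Set (Pt d) :=
  {x | ∃ e ∈ N, x ∈ segment ℝ e.1 e.2}

/-- The length of a rectilinear network: the total length of its segments. Overlapping segments are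
counted separately. Every network can be cut into non-overlapping segments with the same support
without becoming longer, so this does not affect the optimum. -/
noncomputable def networkLength {d : ℕ} (N : Network d) : ℝ :=
  (N.map fun e => manhattanDist e.1 e.2).sum

/-- The total length of the path that visits the given points in this order along axis-parallel
segments. -/
noncomputable def pathLength {d : ℕ} : List (Pt d) → ℝ
  | [] => 0
  | [_] => 0
  | x :: y :: l => manhattanDist x y + pathLength (y :: l)

/-- The set of points on the path that visits the given points in this order. -/
def pathTrace {d : ℕ} : List (Pt d) → Set (Pt d)
  | [] => ∅
  | [x] => {x}
  | x :: y :: l => segment ℝ x y ∪ pathTrace (y :: l)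

/-- `p` is (the list of vertices of) a Manhattan path from `s` to `t`: consecutive vertices are
joined by axis-parallel segments and the total length is the Manhattan distance of `s` and `t`. -/
def IsMPath {d : ℕ} (p : List (Pt d)) (s t : Pt d) : Prop :=
  p.head? = some s ∧ p.getLast? = some t ∧ p.IsChain AxisParallel ∧
    pathLength p = manhattanDist s t

/-- The network contains a Manhattan path from `s` to `t`. -/
def MConnects {d : ℕ} (N : Network d) (s t : Pt d) : Prop :=
  ∃ p : List (Pt d), IsMPath p s t ∧ pathTrace p ⊆ support N

/-! ### The generalized minimum Manhattan network problem -/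

/-- An instance: a list of terminal pairs. -/
abbrev Instance (d : ℕ) : Type := List (Pt d × Pt d)

/-- `N` is a feasible solution of `R`: a rectilinear network that M-connects every pair of `R`. -/
def IsFeasible {d : ℕ} (R : Instance d) (N : Network d) : Prop :=
  IsRectilinear N ∧ ∀ r ∈ R, MConnects N r.1 r.2

/-- `R` is `j`-separated (for `j ≤ d`): in each of the first `j` dimensions a common value
separates the coordinates of all terminal pairs. -/
def IsSeparated {d : ℕ} (j : ℕ) (R : Instance d) : Prop :=
  ∃ s : Fin d → ℝ, ∀ r ∈ R, ∀ i : Fin d, (i : ℕ) < j →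
    (r.1 i ≤ s i ∧ s i ≤ r.2 i) ∨ (r.2 i ≤ s i ∧ s i ≤ r.1 i)

/-! ### A real random access machine with a step count

Programs are written in a structured language with indirect addressing. The memory consists of
banks of integer cells and banks of real cells; a program names the banks it uses (finitely many)
and computes the addresses inside a bank. The only arithmetic operations are additions,
subtractions and comparisons, each at unit cost. There is no rounding and no conversion between
real and integer cells. -/

/-- The memory: contents of cell `k` of bank `b`. -/
structure Store where
  nat : ℕ → ℕ → ℕ
  real : ℕ → ℕ → ℝ

/-- Integer expressions; `cell b e` is the content of integer cell `e` of bank `b`, and `sub` is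
truncated at zero. -/
inductive NExpr where
  | const (m : ℕ)
  | cell (b : ℕ) (e : NExpr)
  | add (e f : NExpr)
  | sub (e f : NExpr)

/-- Real expressions; `cell b e` is the content of real cell `e` of bank `b`. -/
inductive RExpr where
  | const (q : ℚ)
  | cell (b : ℕ) (e : NExpr)
  | add (e f : RExpr)
  | sub (e f : RExpr)

/-- Tests. -/
inductive Test where
  | natLe (e f : NExpr)
  | realLe (e f : RExpr)
  | neg (c : Test)
  | conj (c c' : Test)

def NExpr.eval (σ : Store) : NExpr → ℕ
  | .const m => m
  | .cell b e => σ.nat b (e.eval σ)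
  | .add e f => e.eval σ + f.eval σ
  | .sub e f => e.eval σ - f.eval σ

noncomputable def RExpr.eval (σ : Store) : RExpr → ℝ
  | .const q => (q : ℝ)
  | .cell b e => σ.real b (e.eval σ)
  | .add e f => e.eval σ + f.eval σ
  | .sub e f => e.eval σ - f.eval σ

def Test.Holds (σ : Store) : Test → Prop
  | .natLe e f => e.eval σ ≤ f.eval σ
  | .realLe e f => e.eval σ ≤ f.eval σ
  | .neg c => ¬ c.Holds σ
  | .conj c c' => c.Holds σ ∧ c'.Holds σ

/-- The number of elementary operations in the evaluation of an integer expression. -/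
def NExpr.cost : NExpr → ℕ
  | .const _ => 1
  | .cell _ e => e.cost + 1
  | .add e f => e.cost + f.cost + 1
  | .sub e f => e.cost + f.cost + 1

/-- The number of elementary operations in the evaluation of a real expression. -/
def RExpr.cost : RExpr → ℕ
  | .const _ => 1
  | .cell _ e => e.cost + 1
  | .add e f => e.cost + f.cost + 1
  | .sub e f => e.cost + f.cost + 1

/-- The number of elementary operations in the evaluation of a test. -/
def Test.cost : Test → ℕ
  | .natLe e f => e.cost + f.cost + 1
  | .realLe e f => e.cost + f.cost + 1
  | .neg c => c.cost + 1
  | .conj c c' => c.cost + c'.cost + 1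

/-- Write `v` into integer cell `k` of bank `b`. -/
def Store.setNat (σ : Store) (b k v : ℕ) : Store :=
  { σ with nat := Function.update σ.nat b (Function.update (σ.nat b) k v) }

/-- Write `v` into real cell `k` of bank `b`. -/
noncomputable def Store.setReal (σ : Store) (b k : ℕ) (v : ℝ) : Store :=
  { σ with real := Function.update σ.real b (Function.update (σ.real b) k v) }

/-- Programs. -/
inductive Program where
  | nop
  | setNat (b : ℕ) (addr : NExpr) (val : NExpr)
  | setReal (b : ℕ) (addr : NExpr) (val : RExpr)
  | seq (p q : Program)
  | cond (c : Test) (p q : Program)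
  | loop (c : Test) (p : Program)

/-- `Exec p σ τ t`: started in memory `σ`, the program `p` halts after exactly `t` steps with
memory `τ`. The program `loop c p` repeats `p` as long as `c` holds. -/
inductive Exec : Program → Store → Store → ℕ → Prop where
  | nop (σ : Store) : Exec .nop σ σ 1
  | setNat (σ : Store) (b : ℕ) (addr val : NExpr) :
      Exec (.setNat b addr val) σ (σ.setNat b (addr.eval σ) (val.eval σ))
        (addr.cost + val.cost + 1)
  | setReal (σ : Store) (b : ℕ) (addr : NExpr) (val : RExpr) :
      Exec (.setReal b addr val) σ (σ.setReal b (addr.eval σ) (val.eval σ))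
        (addr.cost + val.cost + 1)
  | seq {p q : Program} {σ τ υ : Store} {t u : ℕ} :
      Exec p σ τ t → Exec q τ υ u → Exec (.seq p q) σ υ (t + u)
  | condTrue {c : Test} {p q : Program} {σ τ : Store} {t : ℕ} :
      c.Holds σ → Exec p σ τ t → Exec (.cond c p q) σ τ (c.cost + t + 1)
  | condFalse {c : Test} {p q : Program} {σ τ : Store} {t : ℕ} :
      ¬ c.Holds σ → Exec q σ τ t → Exec (.cond c p q) σ τ (c.cost + t + 1)
  | loopDone {c : Test} {p : Program} {σ : Store} :
      ¬ c.Holds σ → Exec (.loop c p) σ σ (c.cost + 1)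
  | loopStep {c : Test} {p : Program} {σ τ υ : Store} {t u : ℕ} :
      c.Holds σ → Exec p σ τ t → Exec (.loop c p) τ υ u →
        Exec (.loop c p) σ υ (c.cost + t + u + 1)

/-- The machine is deterministic: the final memory and the number of steps are determined by the
program and the initial memory. -/
theorem Exec.deterministic {p : Program} {σ τ τ' : Store} {t t' : ℕ}
    (h : Exec p σ τ t) (h' : Exec p σ τ' t') : τ = τ' ∧ t = t' := by
  induction h generalizing τ' t' with
  | nop | setNat | setReal => cases h'; exact ⟨rfl, rfl⟩
  | seq _ _ ih₁ ih₂ =>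
    cases h' with
    | seq g₁ g₂ =>
      obtain ⟨rfl, rfl⟩ := ih₁ g₁
      obtain ⟨rfl, rfl⟩ := ih₂ g₂
      exact ⟨rfl, rfl⟩
  | condTrue hc _ ih =>
    cases h' with
    | condTrue _ g => obtain ⟨rfl, rfl⟩ := ih g; exact ⟨rfl, rfl⟩
    | condFalse hn _ => exact absurd hc hn
  | condFalse hc _ ih =>
    cases h' with
    | condTrue hn _ => exact absurd hn hc
    | condFalse _ g => obtain ⟨rfl, rfl⟩ := ih g; exact ⟨rfl, rfl⟩
  | loopDone hc =>
    cases h' with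
    | loopDone _ => exact ⟨rfl, rfl⟩
    | loopStep hn _ _ => exact absurd hn hc
  | loopStep hc _ _ ih₁ ih₂ =>
    cases h' with
    | loopDone hn => exact absurd hc hn
    | loopStep _ g₁ g₂ =>
      obtain ⟨rfl, rfl⟩ := ih₁ g₁
      obtain ⟨rfl, rfl⟩ := ih₂ g₂
      exact ⟨rfl, rfl⟩

/-- The initial memory for the instance `R`: integer cell `0` of bank `0` holds the number of
terminal pairs. For the `k`-th pair `(t, t')`, the `i`-th coordinates of `t` and of `t'` are in
cell `k` of the real banks `i` and `d + i`. All other cells are zero. -/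
noncomputable def encodeInput {d : ℕ} (R : Instance d) : Store where
  nat b k := if b = 0 ∧ k = 0 then R.length else 0
  real b k :=
    if hk : k < R.length then
      if h₁ : b < d then (R[k]).1 ⟨b, h₁⟩
      else if h₂ : b - d < d then (R[k]).2 ⟨b - d, h₂⟩
      else 0
    else 0

/-- The network in the final memory: integer cell `0` of bank `1` holds the number of segments,
and the `i`-th coordinates of the two endpoints of the `k`-th segment are in cell `k` of the real
banks `2 * d + i` and `3 * d + i`. -/
def decodeOutput (d : ℕ) (σ : Store) : Network d :=
  List.ofFn fun k : Fin (σ.nat 1 0) =>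
    ((fun i : Fin d => σ.real (2 * d + i) k), (fun i : Fin d => σ.real (3 * d + i) k))

/-- `j`-separated `d`-dimensional GMMN admits a `ρ(n)`-approximation, where `n` is the number of
terminal pairs: there is one program that, on every `j`-separated instance, halts after a number of
steps polynomial in `n` and outputs a feasible network whose length is at most `ρ n` times the
length of every feasible network, hence at most `ρ n` times the optimum. -/
def AdmitsApproximation (d j : ℕ) (ρ : ℕ → ℝ) : Prop :=
  ∃ (A : Program) (P : Polynomial ℕ), ∀ R : Instance d, IsSeparated j R →
    ∃ (σ : Store) (t : ℕ), Exec A (encodeInput R) σ t ∧ t ≤ P.eval R.length ∧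
      IsFeasible R (decodeOutput d σ) ∧
      ∀ N : Network d, IsFeasible R N →
        networkLength (decodeOutput d σ) ≤ ρ R.length * networkLength N

end GMMN

namespace GMMN

/-! ### Manhattan distances and paths -/

section Geometry

variable {d : ℕ}

/-! Let `s` be a common point of all bounding boxes. Since `s` lies between `t` and `t'` in every
coordinate, Manhattan paths `t → s` and `s → t'` concatenate to one from `t` to `t'`
(`btw_of_separates`, `MConnects.trans`). So it suffices to join every terminal to `s`, and to do so
cheaply compared with an arbitrary feasible network.

Lower bound. Add to a feasible network its projections along all sets of coordinates onto the
hyperplanes `x i = s i`; the length grows by a factor of at most `2 ^ d`. A path from `t` to `t'`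
meets each hyperplane, and a crossing point is fixed by the projection, so path and projections
together stay connected and finally contain `s` (`exists_preconnected_projNet`). Thus all terminals
are connected to `s`. Doubling segments yields a walk through all of them, and shortcutting yields a
spanning edge set on the terminals and `s` of length at most `2 * 2 ^ d` times that of the network
(`span_of_isFeasible`).

Upper bound. Prim's rule, inserting each new point right behind its nearest predecessor, arranges
the points on a path at most twice as long as any spanning edge set (`Span.insert`, `Runs.order`).
Then consecutive points `a`, `b` are repeatedly replaced by the coordinatewise median of `a`, `b`,
`s`. The median lies on shortest paths between any two of the three. Hence a round costs at most the
length of the path, preserves Manhattan paths towards `s`, and does not lengthen the path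
(`pathLength_mergeRound_le`). The number of points halves in each round, so the ratio is `4 * 2 ^ d
* clog 2 (2 * n + 1)`.

Machine. The judgement `Runs` combines a postcondition with a step bound read off the syntax of the
program: no loop is repeated more than `2 * n + 1` times, and work on the `d` coordinates is
unrolled. -/

theorem manhattanDist_nonneg (x y : Pt d) : 0 ≤ manhattanDist x y :=
  Finset.sum_nonneg fun _ _ => abs_nonneg _

@[simp] theorem manhattanDist_self (x : Pt d) : manhattanDist x x = 0 := by
  simp [manhattanDist]

theorem manhattanDist_comm (x y : Pt d) : manhattanDist x y = manhattanDist y x :=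
  Finset.sum_congr rfl fun _ _ => abs_sub_comm _ _

theorem manhattanDist_triangle (x y z : Pt d) :
    manhattanDist x z ≤ manhattanDist x y + manhattanDist y z := by
  unfold manhattanDist
  rw [← Finset.sum_add_distrib]
  exact Finset.sum_le_sum fun _ _ => abs_sub_le _ _ _

/-- `q` lies on a shortest path from `a` to `s`. -/
def Btw (a q s : Pt d) : Prop := manhattanDist a q + manhattanDist q s = manhattanDist a s

theorem Btw.refl (a s : Pt d) : Btw a a s := by simp [Btw]

theorem Btw.trans {a q q' s : Pt d} (h : Btw a q s) (h' : Btw q q' s) : Btw a q' s := by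
  have h₁ := manhattanDist_triangle a q q'
  have h₂ := manhattanDist_triangle a q' s
  unfold Btw at *
  linarith

/-- Two triangle inequalities squeeze the length. This is what allows a Manhattan path ending at `q`
to be extended by a further piece towards `s`. -/
theorem Btw.left {a q q' s : Pt d} (h : Btw a q s) (h' : Btw q q' s) : Btw a q q' := by
  have h₁ := manhattanDist_triangle a q q'
  have h₂ := manhattanDist_triangle a q' s
  unfold Btw at *
  linarith

theorem btw_of_coord {a q s : Pt d} (h : ∀ i, |a i - q i| + |q i - s i| = |a i - s i|) :
    Btw a q s := by
  simp only [Btw, manhattanDist, ← Finset.sum_add_distrib, h]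

theorem btw_of_mem_segment {x y z : Pt d} (h : z ∈ segment ℝ x y) : Btw x z y := by
  obtain ⟨a, b, ha, hb, hab, rfl⟩ := h
  refine btw_of_coord fun i => ?_
  have h₁ : x i - (a • x + b • y) i = b * (x i - y i) := by
    simp only [Pi.add_apply, Pi.smul_apply, smul_eq_mul]; linear_combination (-x i) * hab
  have h₂ : (a • x + b • y) i - y i = a * (x i - y i) := by
    simp only [Pi.add_apply, Pi.smul_apply, smul_eq_mul]; linear_combination (y i) * hab
  rw [h₁, h₂, abs_mul, abs_mul, abs_of_nonneg ha, abs_of_nonneg hb, ← add_mul, add_comm b a, hab,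
    one_mul]

theorem AxisParallel.refl (x : Pt d) : AxisParallel x x := fun _ _ h => absurd rfl h

theorem AxisParallel.symm {x y : Pt d} (h : AxisParallel x y) : AxisParallel y x :=
  fun i j hi hj => h i j hi.symm hj.symm

theorem pathLength_nonneg : ∀ p : List (Pt d), 0 ≤ pathLength p
  | [] => le_rfl
  | [_] => le_rfl
  | x :: y :: l => add_nonneg (manhattanDist_nonneg x y) (pathLength_nonneg (y :: l))

theorem pathLength_append {x y : Pt d} : ∀ {p q : List (Pt d)}, p.getLast? = some x →
    q.head? = some y → pathLength (p ++ q) = pathLength p + manhattanDist x y + pathLength q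
  | [], _, hp, _ => by simp at hp
  | [z], [], _, hq => by simp at hq
  | [z], w :: q, hp, hq => by
    simp at hp hq; subst hp hq; simp [pathLength]
  | z :: w :: p, q, hp, hq => by
    have := pathLength_append (p := w :: p) (q := q) (by simpa using hp) hq
    simp only [List.cons_append, pathLength] at this ⊢
    rw [this]; ring

theorem pathTrace_append {x y : Pt d} : ∀ {p q : List (Pt d)}, p.getLast? = some x →
    q.head? = some y → pathTrace (p ++ q) = pathTrace p ∪ segment ℝ x y ∪ pathTrace q
  | [], _, hp, _ => by simp at hp
  | [z], [], _, hq => by simp at hq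
  | [z], w :: q, hp, hq => by
    simp at hp hq; subst hp hq
    simp only [List.cons_append, List.nil_append, pathTrace]
    rw [Set.union_eq_self_of_subset_left (s := {z})]
    simpa using left_mem_segment ℝ z w
  | z :: w :: p, q, hp, hq => by
    have := pathTrace_append (p := w :: p) (q := q) (by simpa using hp) hq
    simp only [List.cons_append, pathTrace] at this ⊢
    rw [this]; simp only [Set.union_assoc]

theorem mem_pathTrace_of_mem {x : Pt d} : ∀ {p : List (Pt d)}, x ∈ p → x ∈ pathTrace p
  | [], h => by simp at h
  | [z], h => by simpa [pathTrace] using h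
  | z :: w :: p, h => by
    rw [pathTrace]
    rcases List.mem_cons.1 h with rfl | h
    · exact Or.inl (left_mem_segment ℝ _ _)
    · exact Or.inr (mem_pathTrace_of_mem h)

theorem pathLength_reverse : ∀ p : List (Pt d), pathLength p.reverse = pathLength p
  | [] => rfl
  | [_] => rfl
  | x :: y :: l => by
    rw [List.reverse_cons, pathLength_append (x := y) (y := x) (by simp) (by simp),
      pathLength_reverse (y :: l)]
    simp [pathLength, manhattanDist_comm y x, add_comm]

theorem pathTrace_reverse : ∀ p : List (Pt d), pathTrace p.reverse = pathTrace p
  | [] => rfl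
  | [_] => rfl
  | x :: y :: l => by
    rw [List.reverse_cons, pathTrace_append (x := y) (y := x) (by simp) (by simp),
      pathTrace_reverse (y :: l)]
    simp only [pathTrace, segment_symm ℝ y x]
    have : x ∈ segment ℝ x y := left_mem_segment ℝ x y
    ext z
    simp only [Set.mem_union, Set.mem_singleton_iff]
    constructor
    · rintro ((h | h) | rfl)
      exacts [Or.inr h, Or.inl h, Or.inl this]
    · rintro (h | h)
      exacts [Or.inl (Or.inr h), Or.inl (Or.inl h)]

theorem IsMPath.reverse {p : List (Pt d)} {s t : Pt d} (h : IsMPath p s t) :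
    IsMPath p.reverse t s := by
  obtain ⟨h₁, h₂, h₃, h₄⟩ := h
  refine ⟨by simpa using h₂, by simpa using h₁, ?_, ?_⟩
  · rw [List.isChain_reverse]
    exact h₃.imp fun _ _ h => h.symm
  · rw [pathLength_reverse, h₄, manhattanDist_comm]

/-! ### Combining and extending Manhattan connections -/

theorem MConnects.symm {N : Network d} {s t : Pt d} (h : MConnects N s t) : MConnects N t s := by
  obtain ⟨p, hp, hN⟩ := h
  exact ⟨p.reverse, hp.reverse, by rwa [pathTrace_reverse]⟩

/-- The vertex lists are concatenated with `q` repeated; the joint is a degenerate segment, and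
betweenness makes the two lengths add up to the distance. -/
theorem MConnects.trans {N : Network d} {a q s : Pt d} (h : MConnects N a q)
    (h' : MConnects N q s) (hb : Btw a q s) : MConnects N a s := by
  obtain ⟨p, ⟨h₁, h₂, h₃, h₄⟩, hN⟩ := h
  obtain ⟨p', ⟨h₁', h₂', h₃', h₄'⟩, hN'⟩ := h'
  have hne : p ≠ [] := by rintro rfl; simp at h₁
  have hne' : p' ≠ [] := by rintro rfl; simp at h₁'
  refine ⟨p ++ p', ⟨?_, ?_, ?_, ?_⟩, ?_⟩
  · rw [List.head?_append, h₁]; rfl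
  · rw [List.getLast?_append, h₂']; rfl
  · refine List.isChain_append.2 ⟨h₃, h₃', ?_⟩
    intro x hx y hy
    rw [h₂] at hx; rw [h₁'] at hy
    simp only [Option.mem_def, Option.some.injEq] at hx hy
    subst hx hy
    exact AxisParallel.refl _
  · rw [pathLength_append h₂ h₁', h₄, h₄', manhattanDist_self, add_zero, hb]
  · rw [pathTrace_append h₂ h₁', segment_same]
    refine Set.union_subset (Set.union_subset hN ?_) hN'
    rw [Set.singleton_subset_iff]
    exact hN (mem_pathTrace_of_mem (List.mem_of_getLast? h₂))

theorem mconnects_self {N : Network d} {a : Pt d} (h : a ∈ support N) : MConnects N a a :=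
  ⟨[a], ⟨rfl, rfl, by simp, by simp [pathLength]⟩, by simpa [pathTrace] using h⟩

theorem MConnects.right_mem {N : Network d} {a b : Pt d} (h : MConnects N a b) :
    b ∈ support N := by
  obtain ⟨p, ⟨_, h₂, _, _⟩, hN⟩ := h
  exact hN (mem_pathTrace_of_mem (List.mem_of_getLast? h₂))

theorem mconnects_of_segment_subset {N : Network d} {a b : Pt d} (h : AxisParallel a b)
    (hN : segment ℝ a b ⊆ support N) : MConnects N a b := by
  refine ⟨[a, b], ⟨rfl, rfl, by simpa using h, by simp [pathLength]⟩, ?_⟩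
  simp only [pathTrace]
  exact Set.union_subset hN (Set.singleton_subset_iff.2 (hN (right_mem_segment ℝ a b)))

theorem support_append (N M : Network d) : support (N ++ M) = support N ∪ support M := by
  ext x
  simp only [support, List.mem_append, Set.mem_ofPred_eq, Set.mem_union]
  constructor
  · rintro ⟨e, he | he, hx⟩
    exacts [Or.inl ⟨e, he, hx⟩, Or.inr ⟨e, he, hx⟩]
  · rintro (⟨e, he, hx⟩ | ⟨e, he, hx⟩)
    exacts [⟨e, Or.inl he, hx⟩, ⟨e, Or.inr he, hx⟩]

theorem MConnects.append {N : Network d} {a b : Pt d} (h : MConnects N a b) (M : Network d) :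
    MConnects (N ++ M) a b := by
  obtain ⟨p, hp, hN⟩ := h
  exact ⟨p, hp, hN.trans (by rw [support_append]; exact Set.subset_union_left)⟩

theorem networkLength_append (N M : Network d) :
    networkLength (N ++ M) = networkLength N + networkLength M := by
  simp [networkLength]

theorem networkLength_nonneg (N : Network d) : 0 ≤ networkLength N :=
  List.sum_nonneg (by
    simp only [List.mem_map]
    rintro _ ⟨e, _, rfl⟩
    exact manhattanDist_nonneg _ _)

/-- Shortcutting by the triangle inequality. The version with a common first vertex strengthens the
induction. -/
theorem pathLength_le_of_sublist {l l' : List (Pt d)} (h : l.Sublist l') :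
    pathLength l ≤ pathLength l' ∧
      ∀ x, pathLength (x :: l) ≤ pathLength (x :: l') := by
  induction h with
  | slnil => exact ⟨le_rfl, fun _ => le_rfl⟩
  | @cons l₁ l₂ a h ih =>
    have key : pathLength l₁ ≤ pathLength (a :: l₂) := by
      refine ih.1.trans ?_
      cases l₂ with
      | nil => exact le_rfl
      | cons b l => rw [pathLength]; linarith [manhattanDist_nonneg a b]
    refine ⟨key, fun x => ?_⟩
    have h₁ := ih.2 a
    cases l₁ with
    | nil => exact pathLength_nonneg _
    | cons b l =>
      simp only [pathLength] at h₁ ⊢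
      linarith [manhattanDist_triangle x a b]
  | @cons_cons l₁ l₂ a h ih =>
    refine ⟨ih.2 a, fun x => ?_⟩
    have h₁ := ih.2 a
    simp only [pathLength] at h₁ ⊢
    linarith

end Geometry


/-! ### Lower bound on the length of a feasible network -/

section LowerBound

variable {d : ℕ}

/-! ### Projections onto the separating hyperplanes -/

/-- The projection onto the hyperplane `x i = s i`. -/
def projPt (s : Pt d) (i : Fin d) (x : Pt d) : Pt d := Function.update x i (s i)

theorem manhattanDist_projPt_le (s : Pt d) (i : Fin d) (x y : Pt d) :
    manhattanDist (projPt s i x) (projPt s i y) ≤ manhattanDist x y := by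
  refine Finset.sum_le_sum fun j _ => ?_
  by_cases h : j = i
  · subst h; simp [projPt]
  · simp [projPt, h]

theorem projPt_mem_segment (s : Pt d) (i : Fin d) {x y z : Pt d} (h : z ∈ segment ℝ x y) :
    projPt s i z ∈ segment ℝ (projPt s i x) (projPt s i y) := by
  obtain ⟨a, b, ha, hb, hab, rfl⟩ := h
  refine ⟨a, b, ha, hb, hab, ?_⟩
  ext j
  by_cases h : j = i
  · subst h
    simp only [projPt, Pi.add_apply, Pi.smul_apply, Function.update_self, smul_eq_mul]
    rw [← add_mul, hab, one_mul]
  · simp [projPt, h]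

theorem continuous_projPt (s : Pt d) (i : Fin d) : Continuous (projPt s i) :=
  continuous_id.update i continuous_const

/-- The network `N` together with its projections along all subsets of the given coordinates. -/
def projNet (s : Pt d) (N : Network d) : List (Fin d) → Network d
  | [] => N
  | i :: L => projNet s N L ++ (projNet s N L).map fun e => (projPt s i e.1, projPt s i e.2)

/-- The projection along all the given coordinates. -/
def projAll (s : Pt d) (x : Pt d) : List (Fin d) → Pt d
  | [] => x
  | i :: L => projPt s i (projAll s x L)

theorem projAll_apply (s x : Pt d) (L : List (Fin d)) (j : Fin d) :
    projAll s x L j = if j ∈ L then s j else x j := by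
  induction L with
  | nil => simp [projAll]
  | cons i L ih =>
    by_cases h : j = i
    · subst h; simp [projAll, projPt]
    · simp [projAll, projPt, h, ih]

theorem networkLength_projNet_le (s : Pt d) (N : Network d) (L : List (Fin d)) :
    networkLength (projNet s N L) ≤ 2 ^ L.length * networkLength N := by
  induction L with
  | nil => simp [projNet]
  | cons i L ih =>
    have h : networkLength ((projNet s N L).map fun e => (projPt s i e.1, projPt s i e.2)) ≤
        networkLength (projNet s N L) := by
      unfold networkLength
      rw [List.map_map]
      exact List.sum_le_sum fun e _ => manhattanDist_projPt_le s i e.1 e.2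
    rw [projNet, networkLength_append, List.length_cons, pow_succ]
    linarith

theorem isPreconnected_pathTrace : ∀ p : List (Pt d), IsPreconnected (pathTrace p)
  | [] => isPreconnected_empty
  | [_] => isPreconnected_singleton
  | x :: y :: l =>
    IsPreconnected.union y (right_mem_segment ℝ x y) (mem_pathTrace_of_mem (by simp))
      (convex_segment x y).isPreconnected (isPreconnected_pathTrace (y :: l))

/-- The induction keeps both `t` and `t'` in `C`, so that `C` must cross the next hyperplane. The
crossing point lies in `C` and in the projection of `C`, which makes their union connected. -/
theorem exists_preconnected_projNet {s : Pt d} {N : Network d} {t t' : Pt d}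
    (hc : MConnects N t t')
    (hs : ∀ i, (t i ≤ s i ∧ s i ≤ t' i) ∨ (t' i ≤ s i ∧ s i ≤ t i)) (L : List (Fin d)) :
    ∃ C ⊆ support (projNet s N L), IsPreconnected C ∧ t ∈ C ∧ t' ∈ C ∧ projAll s t L ∈ C := by
  induction L with
  | nil =>
    obtain ⟨p, ⟨h₁, h₂, _, _⟩, hN⟩ := hc
    have ht : t ∈ pathTrace p := mem_pathTrace_of_mem (List.mem_of_head? h₁)
    exact ⟨pathTrace p, hN, isPreconnected_pathTrace p, ht,
      mem_pathTrace_of_mem (List.mem_of_getLast? h₂), ht⟩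
  | cons i L ih =>
    obtain ⟨C, hC, hpre, ht, ht', hp⟩ := ih
    have hz : ∃ z ∈ C, z i = s i := by
      have hcont : ContinuousOn (fun x : Pt d => x i) C := (continuous_apply i).continuousOn
      rcases hs i with h | h
      · exact hpre.intermediate_value ht ht' hcont ⟨h.1, h.2⟩
      · exact hpre.intermediate_value ht' ht hcont ⟨h.1, h.2⟩
    obtain ⟨z, hzC, hz⟩ := hz
    have hzz : projPt s i z = z := by
      unfold projPt; rw [← hz]; exact Function.update_eq_self i z
    refine ⟨C ∪ projPt s i '' C, ?_, ?_, Or.inl ht, Or.inl ht', Or.inr ⟨_, hp, rfl⟩⟩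
    · rw [projNet, support_append]
      refine Set.union_subset_union hC ?_
      rintro _ ⟨x, hx, rfl⟩
      obtain ⟨e, he, hxe⟩ := hC hx
      exact ⟨_, List.mem_map_of_mem he, projPt_mem_segment s i hxe⟩
    · exact hpre.union z hzC ⟨z, hzC, hzz⟩
        (hpre.image _ (continuous_projPt s i).continuousOn)

/-! ### Closed walks along a connected network -/

theorem isClosed_segment (x y : Pt d) : IsClosed (segment ℝ x y) := by
  rw [segment_eq_image_lineMap]
  exact (isCompact_Icc.image AffineMap.lineMap_continuous).isClosed

theorem isClosed_pathTrace : ∀ p : List (Pt d), IsClosed (pathTrace p)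
  | [] => isClosed_empty
  | [_] => isClosed_singleton
  | x :: y :: l => (isClosed_segment x y).union (isClosed_pathTrace (y :: l))

theorem isClosed_support (N : Network d) : IsClosed (support N) := by
  have : support N = ⋃ e ∈ {e | e ∈ N}, segment ℝ e.1 e.2 := by
    ext x; simp [support]
  rw [this]
  exact (List.finite_toSet N).isClosed_biUnion fun e _ => isClosed_segment _ _

theorem segment_subset_union_segment {x y z : Pt d} (h : z ∈ segment ℝ x y) :
    segment ℝ x y ⊆ segment ℝ x z ∪ segment ℝ z y := by
  rw [segment_eq_image_lineMap] at h
  obtain ⟨c, hc, rfl⟩ := h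
  intro w hw
  rw [segment_eq_image_lineMap] at hw
  obtain ⟨b, hb, rfl⟩ := hw
  have key : ∀ u v : ℝ, u ∈ Set.Icc (0 : ℝ) v →
      AffineMap.lineMap x y u ∈ segment ℝ x (AffineMap.lineMap x y v : Pt d) := by
    intro u v huv
    have := Set.mem_image_of_mem (AffineMap.lineMap x y : ℝ →ᵃ[ℝ] Pt d)
      (Icc_subset_segment (𝕜 := ℝ) huv)
    rw [image_segment] at this
    simpa using this
  have key' : ∀ u v : ℝ, u ∈ Set.Icc v (1 : ℝ) →
      AffineMap.lineMap x y u ∈ segment ℝ (AffineMap.lineMap x y v : Pt d) y := by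
    intro u v huv
    have := Set.mem_image_of_mem (AffineMap.lineMap x y : ℝ →ᵃ[ℝ] Pt d)
      (Icc_subset_segment (𝕜 := ℝ) huv)
    rw [image_segment] at this
    simpa using this
  rcases le_total b c with h | h
  · exact Or.inl (key b c ⟨hb.1, h⟩)
  · exact Or.inr (key' b c ⟨h, hb.2⟩)

/-- Subdividing a segment at one of its points is free. The sublist clause ensures that vertices
created earlier survive later subdivisions. -/
theorem exists_path_through_point {x : Pt d} : ∀ {W : List (Pt d)}, x ∈ pathTrace W →
    ∃ W' : List (Pt d), W'.head? = W.head? ∧ W.Sublist W' ∧ x ∈ W' ∧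
      pathTrace W ⊆ pathTrace W' ∧ pathLength W' = pathLength W
  | [], h => by simp [pathTrace] at h
  | [z], h => ⟨[z], rfl, List.Sublist.refl _, by simpa [pathTrace] using h, subset_rfl, rfl⟩
  | z :: w :: l, h => by
    rw [pathTrace] at h
    by_cases hx : x ∈ segment ℝ z w
    · refine ⟨z :: x :: w :: l, rfl, by simp, by simp, ?_, ?_⟩
      · simp only [pathTrace, ← Set.union_assoc]
        exact Set.union_subset_union_left _ (segment_subset_union_segment hx)
      · have := btw_of_mem_segment hx
        unfold Btw at this
        simp only [pathLength]
        linarith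
    · have h : x ∈ pathTrace (w :: l) := h.resolve_left hx
      obtain ⟨W', h₁, h₂, h₃, h₄, h₅⟩ := exists_path_through_point h
      cases W' with
      | nil => simp at h₃
      | cons v l' =>
        simp at h₁; subst h₁
        refine ⟨z :: v :: l', rfl, h₂.cons_cons z, List.mem_cons_of_mem _ h₃, ?_, ?_⟩
        · simp only [pathTrace] at h₄ ⊢
          exact Set.union_subset_union_right _ h₄
        · simp only [pathLength] at h₅ ⊢
          rw [h₅]

/-- The detour `x → e.1 → e.2 → x` covers `e`; as `x` lies on `e`, its length is exactly twice that
of `e`. -/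
theorem exists_path_with_detour {x : Pt d} {e : Pt d × Pt d} (he : x ∈ segment ℝ e.1 e.2) :
    ∀ {W : List (Pt d)}, x ∈ W →
    ∃ W' : List (Pt d), W'.head? = W.head? ∧ pathTrace W ⊆ pathTrace W' ∧
      segment ℝ e.1 e.2 ⊆ pathTrace W' ∧
      pathLength W' = pathLength W + 2 * manhattanDist e.1 e.2
  | [], h => by simp at h
  | z :: l, h => by
    by_cases hz : x = z
    · subst hz
      refine ⟨x :: e.1 :: e.2 :: x :: l, rfl, ?_, ?_, ?_⟩
      · simp only [pathTrace]
        intro y hy; exact Or.inr (Or.inr (Or.inr hy))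
      · simp only [pathTrace]
        intro y hy; exact Or.inr (Or.inl hy)
      · have := btw_of_mem_segment he
        unfold Btw at this
        simp only [pathLength, manhattanDist_comm x e.1, manhattanDist_comm e.2 x]
        linarith
    · have h : x ∈ l := by simpa [hz] using h
      obtain ⟨W', h₁, h₄, h₃, h₅⟩ := exists_path_with_detour he h
      cases l with
      | nil => simp at h
      | cons w l =>
        cases W' with
        | nil => simp at h₁
        | cons v l' =>
          simp at h₁; subst h₁
          refine ⟨z :: v :: l', rfl, ?_, ?_, ?_⟩
          · simp only [pathTrace] at h₄ ⊢
            exact Set.union_subset_union_right _ h₄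
          · rw [pathTrace]; exact h₃.trans Set.subset_union_right
          · simp only [pathLength] at h₅ ⊢
            linarith

/-- Induction on the number of unused segments `N`: as long as a point of `D` is missed by the walk,
some unused segment touches the walk and can be absorbed as a detour. -/
theorem exists_walk_of_preconnected {K : Set (Pt d)} {s : Pt d} {D : Set (Pt d)}
    (hD : ∀ p ∈ D, ∃ C ⊆ K, IsPreconnected C ∧ s ∈ C ∧ p ∈ C) (n : ℕ) :
    ∀ (N : Network d) (W : List (Pt d)), N.length = n → K ⊆ pathTrace W ∪ support N →
      W.head? = some s →
      ∃ W' : List (Pt d), W'.head? = some s ∧ D ⊆ pathTrace W' ∧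
        pathLength W' ≤ pathLength W + 2 * networkLength N := by
  induction n with
  | zero =>
    intro N W hN hK hW
    obtain rfl := List.length_eq_zero_iff.1 hN
    refine ⟨W, hW, ?_, by simp [networkLength]⟩
    intro p hp
    obtain ⟨C, hC, _, _, hpC⟩ := hD p hp
    simpa [support] using hK (hC hpC)
  | succ n ih =>
    classical
    intro N W hN hK hW
    by_cases hall : D ⊆ pathTrace W
    · exact ⟨W, hW, hall, by linarith [networkLength_nonneg N]⟩
    obtain ⟨p, hp, hpW⟩ := Set.not_subset.1 hall
    obtain ⟨C, hC, hpre, hsC, hpC⟩ := hD p hp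
    have hpN : p ∈ support N := (hK (hC hpC)).resolve_left hpW
    -- The connected set `C` is covered by two closed sets, the walk (containing `s`) and the unused
    -- part (containing `p`), so these meet in `C`.
    obtain ⟨x, _, hxW, e, he, hxe⟩ := isPreconnected_closed_iff.1 hpre _ _ (isClosed_pathTrace W)
      (isClosed_support N) (hC.trans hK)
      ⟨s, hsC, mem_pathTrace_of_mem (List.mem_of_head? hW)⟩ ⟨p, hpC, hpN⟩
    obtain ⟨W₁, h₁, _, h₃, h₄, h₅⟩ := exists_path_through_point hxW
    obtain ⟨W₂, g₁, g₂, g₃, g₄⟩ := exists_path_with_detour hxe h₃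
    have hlen : networkLength N = manhattanDist e.1 e.2 + networkLength (N.erase e) := by
      unfold networkLength
      rw [((List.perm_cons_erase he).map _).sum_eq]
      simp
    obtain ⟨W', k₁, k₂, k₃⟩ := ih (N.erase e) W₂ (by rw [List.length_erase_of_mem he]; omega)
      (by
        intro y hy
        rcases hK hy with hy | ⟨f, hf, hyf⟩
        · exact Or.inl (g₂ (h₄ hy))
        · by_cases hfe : f = e
          · subst hfe; exact Or.inl (g₃ hyf)
          · exact Or.inr ⟨f, (List.mem_erase_of_ne hfe).2 hf, hyf⟩)
      (by rw [g₁, h₁, hW])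
    exact ⟨W', k₁, k₂, by linarith⟩

theorem exists_walk_through_points (D : List (Pt d)) : ∀ {W : List (Pt d)},
    (∀ p ∈ D, p ∈ pathTrace W) →
    ∃ W' : List (Pt d), W'.head? = W.head? ∧ W.Sublist W' ∧ (∀ p ∈ D, p ∈ W') ∧
      pathLength W' = pathLength W := by
  induction D with
  | nil => intro W _; exact ⟨W, rfl, List.Sublist.refl _, by simp, rfl⟩
  | cons p D ih =>
    intro W hW
    obtain ⟨W₁, h₁, h₂, h₃, h₄, h₅⟩ := exists_path_through_point (hW p (by simp))
    obtain ⟨W₂, g₁, g₂, g₃, g₄⟩ := ih (W := W₁) fun q hq => h₄ (hW q (by simp [hq]))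
    refine ⟨W₂, g₁.trans h₁, h₂.trans g₂, ?_, g₄.trans h₅⟩
    simp only [List.mem_cons, forall_eq_or_imp]
    exact ⟨g₂.subset h₃, g₃⟩

/-! ### Spanning edge sets -/

/-- Adjacency in the graph with the given edges. -/
def EdgeAdj (E : Network d) (x y : Pt d) : Prop := (x, y) ∈ E ∨ (y, x) ∈ E

/-- The points of `D` can be connected to the points of `T` by edges between points of `D` of total
length at most `w`. -/
def Span (D T : Set (Pt d)) (w : ℝ) : Prop :=
  ∃ E : Network d, (∀ e ∈ E, e.1 ∈ D ∧ e.2 ∈ D) ∧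
    (∀ x ∈ D, ∃ t ∈ T, Relation.ReflTransGen (EdgeAdj E) x t) ∧ networkLength E ≤ w

theorem Span.nonneg {D T : Set (Pt d)} {w : ℝ} (h : Span D T w) : 0 ≤ w := by
  obtain ⟨E, _, _, h⟩ := h
  exact (networkLength_nonneg E).trans h

/-- The edges of a path. -/
def pathEdges : List (Pt d) → Network d
  | [] => []
  | [_] => []
  | x :: y :: l => (x, y) :: pathEdges (y :: l)

theorem networkLength_pathEdges : ∀ W : List (Pt d), networkLength (pathEdges W) = pathLength W
  | [] => by simp [pathEdges, networkLength, pathLength]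
  | [_] => by simp [pathEdges, networkLength, pathLength]
  | x :: y :: l => by
    have := networkLength_pathEdges (y :: l)
    unfold networkLength at *
    simp [pathEdges, pathLength, this]

theorem mem_of_mem_pathEdges {e : Pt d × Pt d} : ∀ {W : List (Pt d)}, e ∈ pathEdges W →
    e.1 ∈ W ∧ e.2 ∈ W
  | [], h => by simp [pathEdges] at h
  | [_], h => by simp [pathEdges] at h
  | x :: y :: l, h => by
    rw [pathEdges, List.mem_cons] at h
    rcases h with rfl | h
    · simp
    · have := mem_of_mem_pathEdges h
      exact ⟨List.mem_cons_of_mem _ this.1, List.mem_cons_of_mem _ this.2⟩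

theorem reflTransGen_pathEdges {x : Pt d} : ∀ {W : List (Pt d)} {s : Pt d}, x ∈ s :: W →
    Relation.ReflTransGen (EdgeAdj (pathEdges (s :: W))) x s
  | [], s, h => by simp at h; subst h; exact .refl
  | w :: W, s, h => by
    rcases List.mem_cons.1 h with rfl | h
    · exact .refl
    · have := reflTransGen_pathEdges h
      refine (Relation.ReflTransGen.mono (fun a b hab => ?_) _ _ this).tail
        (Or.inr (by simp [pathEdges]))
      exact hab.imp (List.mem_cons_of_mem _) (List.mem_cons_of_mem _)

/-- Deleting the vertices outside `D` does not lengthen the path, and it keeps the first vertex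
since `s ∈ D`. -/
theorem span_of_path {D : Set (Pt d)} {s : Pt d} {W : List (Pt d)} (hW : W.head? = some s)
    (hs : s ∈ D) (hD : ∀ p ∈ D, p ∈ W) : Span D {s} (pathLength W) := by
  classical
  cases W with
  | nil => simp at hW
  | cons v W =>
    simp at hW; subst hW
    have hf : (v :: W).filter (· ∈ D) = v :: W.filter (· ∈ D) := by simp [hs]
    refine ⟨pathEdges (v :: W.filter (· ∈ D)), ?_, ?_, ?_⟩
    · intro e he
      have := mem_of_mem_pathEdges he
      rw [← hf] at this
      simp only [List.mem_filter, decide_eq_true_eq] at this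
      exact ⟨this.1.2, this.2.2⟩
    · intro x hx
      refine ⟨v, rfl, reflTransGen_pathEdges ?_⟩
      rw [← hf]
      simpa [hx] using hD x hx
    · rw [networkLength_pathEdges, ← hf]
      exact (pathLength_le_of_sublist List.filter_sublist).1

/-- Exchange step: adding a point `j` to `T` that is as close as possible to `T`. -/
theorem Span.insert {D T : Set (Pt d)} {w δ : ℝ} {j : Pt d} (h : Span D T w) (hj : j ∈ D)
    (hδ : ∀ a ∈ T, ∀ b ∈ D, b ∉ T ∨ b = j → δ ≤ manhattanDist a b) :
    Span D (insert j T) (w - δ) := by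
  classical
  obtain ⟨E, hED, hET, hw⟩ := h
  -- Terminals may coincide. If `j` is already in `T`, the hypothesis for the pair `(j, j)` gives `δ
  -- ≤ 0`, and nothing has to be removed.
  by_cases hjT : j ∈ T
  · have := hδ j hjT j hj (Or.inr rfl)
    rw [manhattanDist_self] at this
    rw [Set.insert_eq_of_mem hjT]
    exact ⟨E, hED, hET, by linarith⟩
  let A : Pt d → Pt d → Prop := fun x y => EdgeAdj E x y ∧ x ∉ T ∧ y ∉ T
  obtain ⟨t, ht, hjt⟩ := hET j hj
  -- Follow a walk from `j` to `T` up to its first edge entering `T`. This edge has length at least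
  -- `δ` and is the one to remove.
  have hcross : ∃ b a, Relation.ReflTransGen A j b ∧ b ∉ T ∧ a ∈ T ∧ EdgeAdj E b a := by
    have : ∀ x, Relation.ReflTransGen (EdgeAdj E) j x →
        (Relation.ReflTransGen A j x ∧ x ∉ T) ∨
        ∃ b a, Relation.ReflTransGen A j b ∧ b ∉ T ∧ a ∈ T ∧ EdgeAdj E b a := by
      intro x hx
      induction hx with
      | refl => exact Or.inl ⟨.refl, hjT⟩
      | @tail y z _ hyz ih =>
        rcases ih with ⟨h₁, h₂⟩ | h
        · by_cases hz : z ∈ T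
          · exact Or.inr ⟨y, z, h₁, h₂, hz, hyz⟩
          · exact Or.inl ⟨h₁.tail ⟨hyz, h₂, hz⟩, hz⟩
        · exact Or.inr h
    exact (this t hjt).resolve_left fun h => h.2 ht
  obtain ⟨b, a, hjb, hb, ha, hba⟩ := hcross
  obtain ⟨f, hfE, hf⟩ : ∃ f ∈ E, f = (b, a) ∨ f = (a, b) := by
    rcases hba with h | h
    exacts [⟨_, h, Or.inl rfl⟩, ⟨_, h, Or.inr rfl⟩]
  have hbD : b ∈ D := by
    have := hED f hfE
    rcases hf with rfl | rfl
    exacts [this.1, this.2]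
  have hlen : networkLength E = manhattanDist f.1 f.2 + networkLength (E.erase f) := by
    unfold networkLength
    rw [((List.perm_cons_erase hfE).map _).sum_eq]
    simp
  have hfδ : δ ≤ manhattanDist f.1 f.2 := by
    have := hδ a ha b hbD (Or.inl hb)
    rcases hf with rfl | rfl
    · rwa [manhattanDist_comm]
    · exact this
  have hne : ∀ e : Pt d × Pt d, e ∈ E → e ≠ f → e ∈ E.erase f :=
    fun e he hef => (List.mem_erase_of_ne hef).2 he
  -- The initial part of the walk stays outside `T`, so it avoids the removed edge `f`, which has
  -- its endpoint `a` in `T`.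
  have hbj : Relation.ReflTransGen (EdgeAdj (E.erase f)) b j := by
    have : ∀ x, Relation.ReflTransGen A j x →
        Relation.ReflTransGen (EdgeAdj (E.erase f)) x j := by
      intro x hx
      induction hx with
      | refl => exact .refl
      | @tail y z _ hyz ih =>
        obtain ⟨hE, hy, hz⟩ := hyz
        refine .head ?_ ih
        rcases hE with h | h
        · refine Or.inr (hne _ h ?_)
          rintro rfl
          rcases hf with h | h <;> simp only [Prod.mk.injEq] at h
          · exact hz (h.2 ▸ ha)
          · exact hy (h.1 ▸ ha)
        · refine Or.inl (hne _ h ?_)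
          rintro rfl
          rcases hf with h | h <;> simp only [Prod.mk.injEq] at h
          · exact hy (h.2 ▸ ha)
          · exact hz (h.1 ▸ ha)
    exact this b hjb
  refine ⟨E.erase f, fun e he => hED e (List.mem_of_mem_erase he), ?_, by linarith⟩
  intro x hx
  obtain ⟨t, ht, hxt⟩ := hET x hx
  induction hxt using Relation.ReflTransGen.head_induction_on with
  | refl => exact ⟨t, Or.inr ht, .refl⟩
  | @head x y hxy _ ih =>
    have hyD : y ∈ D := by
      rcases hxy with h | h
      exacts [(hED _ h).2, (hED _ h).1]
    obtain ⟨t', ht', hyt'⟩ := ih hyD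
    -- Where the old walk uses `f`, it is at `a ∈ T` or at `b`, which still reaches `j`.
    by_cases hxf : (x, y) = f ∨ (y, x) = f
    · have : x = a ∨ x = b := by
        rcases hxf with rfl | rfl <;> rcases hf with h | h <;>
          simp only [Prod.mk.injEq] at h <;> tauto
      rcases this with rfl | rfl
      · exact ⟨x, Or.inr ha, .refl⟩
      · exact ⟨j, Or.inl rfl, hbj⟩
    · push Not at hxf
      exact ⟨t', ht', .head (hxy.imp (fun h => hne _ h hxf.1) (fun h => hne _ h hxf.2)) hyt'⟩

/-! ### From feasible networks to spanning edge sets -/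

/-- All terminals and the common point `s`. -/
def terminals (R : Instance d) (s : Pt d) : Set (Pt d) :=
  {p | p = s ∨ ∃ r ∈ R, p = r.1 ∨ p = r.2}

/-- `s` lies in the bounding boxes of all pairs. -/
def Separates (R : Instance d) (s : Pt d) : Prop :=
  ∀ r ∈ R, ∀ i, (r.1 i ≤ s i ∧ s i ≤ r.2 i) ∨ (r.2 i ≤ s i ∧ s i ≤ r.1 i)

theorem span_of_isFeasible {R : Instance d} {s : Pt d} (hs : Separates R s) {N : Network d}
    (hN : IsFeasible R N) : Span (terminals R s) {s} (2 * (2 ^ d * networkLength N)) := by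
  classical
  set M := projNet s N (List.finRange d) with hM
  -- The singleton `{s}` is added because `s` need not lie on the network when there are no pairs.
  have hconn : ∀ p ∈ terminals R s, ∃ C ⊆ support M ∪ {s}, IsPreconnected C ∧ s ∈ C ∧ p ∈ C := by
    have hall : ∀ x, projAll s x (List.finRange d) = s := by
      intro x; ext j; simp [projAll_apply]
    rintro p (rfl | ⟨r, hr, hp⟩)
    · exact ⟨{p}, by simp, isPreconnected_singleton, rfl, rfl⟩
    · obtain ⟨C, hC, hpre, ht, ht', hps⟩ :=
        exists_preconnected_projNet (hN.2 r hr) (hs r hr) (List.finRange d)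
      rw [hall] at hps
      refine ⟨C, hC.trans Set.subset_union_left, hpre, hps, ?_⟩
      rcases hp with rfl | rfl <;> assumption
  obtain ⟨W, h₁, h₂, h₃⟩ := exists_walk_of_preconnected hconn _ M [s] rfl
    (by simp [pathTrace]) rfl
  obtain ⟨W', g₁, _, g₃, g₄⟩ := exists_walk_through_points
    (s :: R.flatMap fun r => [r.1, r.2]) (W := W) (by
      intro p hp
      refine h₂ ?_
      simp only [List.mem_cons, List.mem_flatMap, List.not_mem_nil, or_false] at hp
      exact hp)
  obtain ⟨E, e₁, e₂, e₃⟩ := span_of_path (D := terminals R s) (g₁.trans h₁) (Or.inl rfl) (by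
    intro p hp
    refine g₃ p ?_
    simp only [List.mem_cons, List.mem_flatMap, List.not_mem_nil, or_false]
    exact hp)
  refine ⟨E, e₁, e₂, ?_⟩
  have := networkLength_projNet_le s N (List.finRange d)
  rw [List.length_finRange, ← hM] at this
  simp only [pathLength, zero_add] at h₃
  linarith

end LowerBound


/-! ### Geometry of merging and of insertion into a path -/

section Merging

variable {d : ℕ}

/-! ### Meeting points -/

/-- The median of `a`, `b` and `s`. -/
noncomputable def medR (s a b : ℝ) : ℝ :=
  if a ≤ b then if b ≤ s then b else if s ≤ a then a else s
  else if a ≤ s then a else if s ≤ b then b else s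

theorem medR_left (s a b : ℝ) : |a - medR s a b| + |medR s a b - s| = |a - s| := by
  unfold medR
  split_ifs <;> grind

theorem medR_right (s a b : ℝ) : |b - medR s a b| + |medR s a b - s| = |b - s| := by
  unfold medR
  split_ifs <;> grind

theorem medR_between (s a b : ℝ) : |a - medR s a b| + |medR s a b - b| = |a - b| := by
  unfold medR
  split_ifs <;> grind

/-- Merging `s` with any point returns `s`; hence `s` stays the first point in all rounds. -/
theorem medR_self (s b : ℝ) : medR s s b = s := by
  unfold medR
  split_ifs <;> grind

/-- The coordinatewise median. -/
noncomputable def med (s a b : Pt d) : Pt d := fun i => medR (s i) (a i) (b i)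

theorem btw_med_left (s a b : Pt d) : Btw a (med s a b) s :=
  btw_of_coord fun _ => medR_left _ _ _

theorem btw_med_right (s a b : Pt d) : Btw b (med s a b) s :=
  btw_of_coord fun _ => medR_right _ _ _

theorem btw_med (s a b : Pt d) : Btw a (med s a b) b :=
  btw_of_coord fun _ => medR_between _ _ _

theorem med_self (s b : Pt d) : med s s b = s := funext fun _ => medR_self _ _

/-- One round: consecutive points are merged in pairs. -/
noncomputable def mergeRound (s : Pt d) : List (Pt d) → List (Pt d)
  | [] => []
  | [a] => [a]
  | a :: b :: l => med s a b :: mergeRound s l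

/-- The cost of one round. -/
noncomputable def pairCost : List (Pt d) → ℝ
  | [] => 0
  | [_] => 0
  | a :: b :: l => manhattanDist a b + pairCost l

/-- The merged pairs are every other edge of the path. -/
theorem pairCost_le_pathLength : ∀ l : List (Pt d), pairCost l ≤ pathLength l
  | [] => le_rfl
  | [_] => le_rfl
  | [a, b] => by simp [pairCost, pathLength]
  | a :: b :: c :: l => by
    have := pairCost_le_pathLength (c :: l)
    have := manhattanDist_nonneg b c
    simp only [pairCost, pathLength] at *
    linarith

/-- The median subdivides the step from `a` to `b` without loss, and the new path then skips `a` and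
`b`. The version with a preceding point `x` carries the induction. -/
theorem pathLength_mergeRound_le (s : Pt d) : ∀ l : List (Pt d),
    pathLength (mergeRound s l) ≤ pathLength l ∧
      ∀ x, pathLength (x :: mergeRound s l) ≤ pathLength (x :: l)
  | [] => by simp [mergeRound]
  | [a] => by simp [mergeRound]
  | a :: b :: l => by
    have ih := (pathLength_mergeRound_le s l).2
    have hm : manhattanDist (med s a b) b + pathLength (mergeRound s l) ≥ 0 :=
      add_nonneg (manhattanDist_nonneg _ _) (pathLength_nonneg _)
    have h₁ : pathLength (med s a b :: mergeRound s l) ≤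
        manhattanDist (med s a b) b + pathLength (b :: l) := by
      refine le_trans ?_ (add_le_add_right (ih b) _)
      cases h : mergeRound s l with
      | nil => simpa [pathLength] using manhattanDist_nonneg _ _
      | cons c t =>
        simp only [pathLength]
        linarith [manhattanDist_triangle (med s a b) b c]
    have h₂ := btw_med s a b
    unfold Btw at h₂
    refine ⟨?_, fun x => ?_⟩
    · simp only [mergeRound]
      rw [pathLength]
      linarith [manhattanDist_nonneg a (med s a b)]
    · simp only [mergeRound]
      rw [pathLength, pathLength, pathLength]
      linarith [manhattanDist_triangle x a (med s a b)]

/-! ### Points stored in arrays -/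

/-- The first `m` entries. -/
def arr (X : ℕ → Pt d) (m : ℕ) : List (Pt d) := (List.range m).map X

theorem arr_congr {X Y : ℕ → Pt d} {m : ℕ} (h : ∀ q < m, X q = Y q) : arr X m = arr Y m :=
  List.map_congr_left fun q hq => h q (List.mem_range.1 hq)

theorem arr_add (X : ℕ → Pt d) (a b : ℕ) :
    arr X (a + b) = arr X a ++ arr (fun q => X (a + q)) b := by
  simp [arr, List.range_add, Function.comp_def]

theorem arr_one_add (X : ℕ → Pt d) (b : ℕ) :
    arr X (b + 1) = X 0 :: arr (fun q => X (q + 1)) b := by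
  rw [add_comm, arr_add]; simp [arr, add_comm]

/-- Going from `a` to `x` and back bounds the cost of visiting `x` right after `a`. -/
theorem pathLength_insert_le (a x : Pt d) (B : List (Pt d)) : ∀ A : List (Pt d),
    pathLength (A ++ a :: x :: B) ≤ pathLength (A ++ a :: B) + 2 * manhattanDist a x
  | [] => by
    have := manhattanDist_nonneg a x
    cases B with
    | nil => simp only [List.nil_append, pathLength]; linarith
    | cons b B =>
      simp only [List.nil_append, pathLength]
      linarith [manhattanDist_triangle x a b, manhattanDist_comm a x]
  | [c] => by
    have := pathLength_insert_le a x B []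
    simp only [List.nil_append, List.cons_append, pathLength] at *
    linarith
  | c :: e :: A => by
    have := pathLength_insert_le a x B (e :: A)
    simp only [List.cons_append, pathLength] at *
    linarith

theorem pathLength_arr_insert_le {X Y : ℕ → Pt d} {i k : ℕ} {x : Pt d} (hik : i < k)
    (h₁ : ∀ q ≤ i, Y q = X q) (h₂ : Y (i + 1) = x) (h₃ : ∀ q, i < q → q < k → Y (q + 1) = X q) :
    pathLength (arr Y (k + 1)) ≤ pathLength (arr X k) + 2 * manhattanDist (X i) x := by
  obtain ⟨c, rfl⟩ : ∃ c, k = i + (c + 1) := ⟨k - i - 1, by omega⟩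
  have hY : arr Y (i + (c + 1) + 1) = arr X i ++ X i :: x :: arr (fun q => X (i + (q + 1))) c := by
    rw [add_assoc, arr_add, arr_one_add, arr_one_add]
    congr 1
    · exact arr_congr fun q hq => h₁ q hq.le
    · simp only [zero_add, add_zero, h₁ i le_rfl, h₂, List.cons.injEq, true_and]
      exact arr_congr fun q hq => h₃ (i + (q + 1)) (by omega) (by omega)
  rw [hY, arr_add, arr_one_add]
  exact pathLength_insert_le _ _ _ _

/-- Links the array contents after a round to the recursion on lists; for odd `m` the last point is
carried over unmerged. -/
theorem arr_mergeRound (s : Pt d) : ∀ (m : ℕ) (X Y : ℕ → Pt d),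
    (∀ q, 2 * q + 1 < m → Y q = med s (X (2 * q)) (X (2 * q + 1))) →
    (∀ q, 2 * q + 1 = m → Y q = X (2 * q)) →
    arr Y ((m + 1) / 2) = mergeRound s (arr X m)
  | 0, X, Y, _, _ => by simp [arr, mergeRound]
  | 1, X, Y, _, h₂ => by simpa [arr, mergeRound] using h₂ 0 rfl
  | m + 2, X, Y, h₁, h₂ => by
    have : (m + 2 + 1) / 2 = (m + 1) / 2 + 1 := by omega
    rw [this, arr_one_add, arr_one_add, arr_one_add, mergeRound, h₁ 0 (by omega)]
    congr 1
    exact arr_mergeRound s m _ _ (fun q hq => h₁ (q + 1) (by omega))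
      (fun q hq => h₂ (q + 1) (by omega))

theorem sum_pairs_eq_pairCost : ∀ (m : ℕ) (X : ℕ → Pt d),
    ∑ q ∈ Finset.range (m / 2), manhattanDist (X (2 * q)) (X (2 * q + 1)) = pairCost (arr X m)
  | 0, X => by simp [arr, pairCost]
  | 1, X => by simp [arr, pairCost]
  | m + 2, X => by
    have : (m + 2) / 2 = m / 2 + 1 := by omega
    rw [this, Finset.sum_range_succ', arr_one_add, arr_one_add, pairCost,
      ← sum_pairs_eq_pairCost m, add_comm]
    rfl

end Merging


/-! ### Reasoning about programs -/

/-- A bound on the number of steps of a program all of whose loops are repeated at most `X`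
times. -/
noncomputable def Program.bound : Program → Polynomial ℕ
  | .nop => 1
  | .setNat _ e f => Polynomial.C (e.cost + f.cost + 1)
  | .setReal _ e f => Polynomial.C (e.cost + f.cost + 1)
  | .seq p q => p.bound + q.bound
  | .cond c p q => Polynomial.C c.cost + p.bound + q.bound + 1
  | .loop c p => Polynomial.X * (Polynomial.C c.cost + p.bound + 1) + Polynomial.C c.cost + 1

/-- Started in `σ`, the program halts within the bound for `N` loop repetitions in a memory that
satisfies `Q`. -/
def Runs (N : ℕ) (p : Program) (σ : Store) (Q : Store → Prop) : Prop :=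
  ∃ τ t, Exec p σ τ t ∧ t ≤ p.bound.eval N ∧ Q τ

section Rules

variable {N : ℕ} {σ : Store} {Q : Store → Prop}

theorem Runs.mono {p : Program} {Q' : Store → Prop} (h : Runs N p σ Q') (hQ : ∀ τ, Q' τ → Q τ) :
    Runs N p σ Q := by
  obtain ⟨τ, t, h₁, h₂, h₃⟩ := h
  exact ⟨τ, t, h₁, h₂, hQ τ h₃⟩

theorem Runs.nop (h : Q σ) : Runs N .nop σ Q :=
  ⟨σ, 1, .nop σ, by simp [Program.bound], h⟩

theorem Runs.setNat {b : ℕ} {e f : NExpr} (h : Q (σ.setNat b (e.eval σ) (f.eval σ))) :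
    Runs N (.setNat b e f) σ Q :=
  ⟨_, _, .setNat σ b e f, by simp [Program.bound], h⟩

theorem Runs.setReal {b : ℕ} {e : NExpr} {f : RExpr}
    (h : Q (σ.setReal b (e.eval σ) (f.eval σ))) : Runs N (.setReal b e f) σ Q :=
  ⟨_, _, .setReal σ b e f, by simp [Program.bound], h⟩

theorem Runs.seq {p q : Program} (h : Runs N p σ fun τ => Runs N q τ Q) :
    Runs N (.seq p q) σ Q := by
  obtain ⟨τ, t, h₁, h₂, υ, u, g₁, g₂, g₃⟩ := h
  exact ⟨υ, t + u, .seq h₁ g₁, by simpa [Program.bound] using add_le_add h₂ g₂, g₃⟩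

theorem Runs.cond {c : Test} {p q : Program} (h₁ : c.Holds σ → Runs N p σ Q)
    (h₂ : ¬ c.Holds σ → Runs N q σ Q) : Runs N (.cond c p q) σ Q := by
  by_cases hc : c.Holds σ
  · obtain ⟨τ, t, g₁, g₂, g₃⟩ := h₁ hc
    exact ⟨τ, _, .condTrue hc g₁, by simp [Program.bound]; omega, g₃⟩
  · obtain ⟨τ, t, g₁, g₂, g₃⟩ := h₂ hc
    exact ⟨τ, _, .condFalse hc g₁, by simp [Program.bound]; omega, g₃⟩

/-- `I k` describes the memory after `k` repetitions. Termination needs no separate measure: the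
invariant together with the test has to force `k < N`. -/
theorem Runs.loop {c : Test} {p : Program} (I : ℕ → Store → Prop) (h₀ : I 0 σ)
    (hstep : ∀ k τ, I k τ → c.Holds τ → k < N ∧ Runs N p τ (I (k + 1)))
    (hdone : ∀ k τ, I k τ → ¬ c.Holds τ → Q τ) : Runs N (.loop c p) σ Q := by
  have key : ∀ j k σ, k + j = N → I k σ → ∃ τ t, Exec (.loop c p) σ τ t ∧
      t ≤ j * (c.cost + p.bound.eval N + 1) + c.cost + 1 ∧ Q τ := by
    intro j
    induction j with
    | zero =>
      intro k σ hk hI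
      have hc : ¬ c.Holds σ := fun hc => by have := (hstep k σ hI hc).1; omega
      exact ⟨σ, _, .loopDone hc, by omega, hdone k σ hI hc⟩
    | succ j ih =>
      intro k σ hk hI
      by_cases hc : c.Holds σ
      · obtain ⟨τ, t, h₁, h₂, h₃⟩ := (hstep k σ hI hc).2
        obtain ⟨υ, u, g₁, g₂, g₃⟩ := ih (k + 1) τ (by omega) h₃
        refine ⟨υ, _, .loopStep hc h₁ g₁, ?_, g₃⟩
        rw [add_mul]; omega
      · exact ⟨σ, _, .loopDone hc, by omega, hdone k σ hI hc⟩
  obtain ⟨τ, t, h₁, h₂, h₃⟩ := key N 0 σ (by omega) h₀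
  exact ⟨τ, t, h₁, by simpa [Program.bound] using h₂, h₃⟩

/-- `f 0; f 1; …; f (k - 1)`. -/
def unroll (f : ℕ → Program) : ℕ → Program
  | 0 => .nop
  | k + 1 => .seq (unroll f k) (f k)

theorem Runs.iter {f : ℕ → Program} (I : ℕ → Store → Prop) {k : ℕ} (h₀ : I 0 σ)
    (hstep : ∀ i < k, ∀ τ, I i τ → Runs N (f i) τ (I (i + 1))) (hQ : ∀ τ, I k τ → Q τ) :
    Runs N (unroll f k) σ Q := by
  induction k generalizing Q with
  | zero => exact .nop (hQ σ h₀)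
  | succ k ih =>
    exact .seq (ih (fun i hi => hstep i (by omega))
      fun τ hτ => (hstep k (by omega) τ hτ).mono hQ)

end Rules

/-! ### Views of the memory -/

namespace Store

/-- The integer variable `b`. -/
def v (σ : Store) (b : ℕ) : ℕ := σ.nat b 0

/-- The `k`-th point in the `c`-th array of points. -/
def pt (d : ℕ) (σ : Store) (c k : ℕ) : Pt d := fun i => σ.real (c * d + i) k

/-- The real variable `w`. -/
def scal (d : ℕ) (σ : Store) (w : ℕ) : ℝ := σ.real (6 * d + w) 0

/-- Assign the integer variable `b`. -/
def setV (σ : Store) (b x : ℕ) : Store := σ.setNat b 0 x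

/-- Assign the real variable `w`. -/
noncomputable def setScal (d : ℕ) (σ : Store) (w : ℕ) (x : ℝ) : Store := σ.setReal (6 * d + w) 0 x

/-- Assign the first `j` coordinates of the point `k` of array `c`. -/
noncomputable def setCoords (d : ℕ) (σ : Store) (c k : ℕ) (w : ℕ → ℝ) : ℕ → Store
  | 0 => σ
  | j + 1 => (setCoords d σ c k w j).setReal (c * d + j) k (w j)

/-- Assign the point `k` of array `c`. -/
noncomputable def setPt (d : ℕ) (σ : Store) (c k : ℕ) (x : Pt d) : Store :=
  σ.setCoords d c k (fun j => if h : j < d then x ⟨j, h⟩ else 0) d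

variable {d : ℕ} (σ : Store)

theorem v_setV (b x b' : ℕ) : (σ.setV b x).v b' = if b' = b then x else σ.v b' := by
  by_cases h : b' = b
  · subst h; simp [v, setV, setNat]
  · simp [v, setV, setNat, h]

@[simp] theorem v_setReal (b k : ℕ) (x : ℝ) (b' : ℕ) : (σ.setReal b k x).v b' = σ.v b' := rfl

@[simp] theorem v_setScal (w : ℕ) (x : ℝ) (b' : ℕ) : (σ.setScal d w x).v b' = σ.v b' := rfl

@[simp] theorem nat_setReal (b k : ℕ) (x : ℝ) : (σ.setReal b k x).nat = σ.nat := rfl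

@[simp] theorem nat_setCoords (c k : ℕ) (w : ℕ → ℝ) (j : ℕ) :
    (σ.setCoords d c k w j).nat = σ.nat := by
  induction j with
  | zero => rfl
  | succ j ih => simpa [setCoords] using ih

@[simp] theorem v_setPt (c k : ℕ) (x : Pt d) (b' : ℕ) : (σ.setPt d c k x).v b' = σ.v b' := by
  simp [v, setPt]

@[simp] theorem pt_setV (b x c k : ℕ) : (σ.setV b x).pt d c k = σ.pt d c k := rfl

@[simp] theorem scal_setV (b x w : ℕ) : (σ.setV b x).scal d w = σ.scal d w := rfl

theorem real_setReal (b k : ℕ) (x : ℝ) (b' k' : ℕ) :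
    (σ.setReal b k x).real b' k' = if b' = b ∧ k' = k then x else σ.real b' k' := by
  by_cases h : b' = b
  · subst h
    by_cases h : k' = k
    · subst h; simp [setReal]
    · simp [setReal, h]
  · simp [setReal, h]

theorem real_setCoords (c k : ℕ) (w : ℕ → ℝ) (j b' k' : ℕ) :
    (σ.setCoords d c k w j).real b' k' =
      if c * d ≤ b' ∧ b' < c * d + j ∧ k' = k then w (b' - c * d) else σ.real b' k' := by
  induction j with
  | zero => simp only [setCoords]; rw [if_neg (by omega)]
  | succ j ih =>
    rw [setCoords, real_setReal, ih]
    by_cases h : b' = c * d + j ∧ k' = k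
    · obtain ⟨rfl, rfl⟩ := h; simp
    · rw [if_neg h]
      refine if_congr ?_ rfl rfl
      omega

/-- Quotient and remainder modulo `d` show that distinct arrays and coordinates use distinct banks.
Arrays `0`, `1` hold the input and `2`, `3` the output, `4` holds the current points, and `5` holds
a current position, `s` and a median in its cells `0`, `1`, `2`. -/
theorem bank_eq {c c' i j : ℕ} (hi : i < d) (hj : j < d) (h : c * d + i = c' * d + j) :
    c = c' ∧ i = j := by
  have h₁ : (c * d + i) / d = c := by
    rw [mul_comm, Nat.mul_add_div (by omega), Nat.div_eq_of_lt hi, add_zero]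
  have h₂ : (c' * d + j) / d = c' := by
    rw [mul_comm, Nat.mul_add_div (by omega), Nat.div_eq_of_lt hj, add_zero]
  have h₃ : c = c' := by rw [← h₁, ← h₂, h]
  subst h₃
  exact ⟨rfl, by omega⟩

theorem pt_setPt (c k : ℕ) (x : Pt d) (c' k' : ℕ) :
    (σ.setPt d c k x).pt d c' k' = if c' = c ∧ k' = k then x else σ.pt d c' k' := by
  ext i
  simp only [pt, setPt, real_setCoords]
  have hi := i.2
  by_cases h : c' = c ∧ k' = k
  · obtain ⟨rfl, rfl⟩ := h
    simp
  · rw [if_neg h, if_neg]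
    · rfl
    rintro ⟨h₁, h₂, h₃⟩
    obtain ⟨e, he⟩ : ∃ e, c' * d + i = c * d + e := ⟨c' * d + i - c * d, by omega⟩
    exact h ⟨(bank_eq i.2 (by omega) he).1, h₃⟩

theorem bank_lt {c i : ℕ} (hc : c < 6) (hi : i < d) : c * d + i < 6 * d := by
  have : (c + 1) * d ≤ 6 * d := Nat.mul_le_mul_right d hc
  rw [add_mul] at this
  omega

theorem pt_setScal (w : ℕ) (x : ℝ) {c : ℕ} (hc : c < 6) (k : ℕ) :
    (σ.setScal d w x).pt d c k = σ.pt d c k := by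
  ext i
  simp only [pt, setScal, real_setReal]
  have := bank_lt hc i.2
  rw [if_neg (by omega)]

theorem scal_setScal (w : ℕ) (x : ℝ) (w' : ℕ) :
    (σ.setScal d w x).scal d w' = if w' = w then x else σ.scal d w' := by
  simp [scal, setScal, real_setReal]

theorem setScal_setScal (w : ℕ) (x y : ℝ) :
    (σ.setScal d w x).setScal d w y = σ.setScal d w y := by
  simp [setScal, setReal]

end Store

theorem NExpr.eval_congr {σ τ : Store} (h : τ.nat = σ.nat) (e : NExpr) :
    e.eval τ = e.eval σ := by
  induction e with
  | const m => rfl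
  | cell b e ih => simp [NExpr.eval, ih, h]
  | add e f ih₁ ih₂ => simp [NExpr.eval, ih₁, ih₂]
  | sub e f ih₁ ih₂ => simp [NExpr.eval, ih₁, ih₂]

/-! ### Building blocks -/

/-- The integer variable `b` as an expression. -/
abbrev var (b : ℕ) : NExpr := .cell b (.const 0)

@[simp] theorem eval_var (σ : Store) (b : ℕ) : (var b).eval σ = σ.v b := rfl

@[simp] theorem eval_const (σ : Store) (m : ℕ) : (NExpr.const m).eval σ = m := rfl

@[simp] theorem eval_add (σ : Store) (e f : NExpr) :
    (NExpr.add e f).eval σ = e.eval σ + f.eval σ := rfl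

@[simp] theorem eval_sub (σ : Store) (e f : NExpr) :
    (NExpr.sub e f).eval σ = e.eval σ - f.eval σ := rfl

/-- Assign an integer variable. -/
abbrev assign (b : ℕ) (e : NExpr) : Program := .setNat b (.const 0) e

theorem Runs.assign {N : ℕ} {σ : Store} {Q : Store → Prop} {b : ℕ} {e : NExpr}
    (h : Q (σ.setV b (e.eval σ))) : Runs N (assign b e) σ Q := .setNat h

/-- The test `e < f`. -/
abbrev lt (e f : NExpr) : Test := .natLe (.add e (.const 1)) f

theorem holds_lt {σ : Store} {e f : NExpr} : (lt e f).Holds σ ↔ e.eval σ < f.eval σ := Iff.rfl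

section Blocks

variable (d : ℕ) {N : ℕ} {σ : Store} {Q : Store → Prop}

/-- A point is assigned coordinate by coordinate. -/
theorem Runs.coords {c k : ℕ} {f : ℕ → Program} {x : Pt d}
    (hf : ∀ i (hi : i < d) τ, τ.nat = σ.nat →
      (∀ c' k', τ.real (c' * d + i) k' = σ.real (c' * d + i) k') →
      Runs N (f i) τ (· = τ.setReal (c * d + i) k (x ⟨i, hi⟩)))
    (hQ : Q (σ.setPt d c k x)) : Runs N (unroll f d) σ Q := by
  refine .iter (fun j τ => τ =
    σ.setCoords d c k (fun j => if h : j < d then x ⟨j, h⟩ else 0) j) rfl ?_ ?_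
  · rintro i hi _ rfl
    refine (hf i hi _ (by simp) ?_).mono ?_
    -- Only coordinates below `i` have been written so far, so coordinate `i` is untouched in all
    -- arrays.
    · intro c' k'
      rw [Store.real_setCoords, if_neg]
      rintro ⟨h₁, h₂, -⟩
      obtain ⟨e, he⟩ : ∃ e, c' * d + i = c * d + e := ⟨c' * d + i - c * d, by omega⟩
      have := (Store.bank_eq hi (by omega) he).2
      omega
    · rintro _ rfl
      simp [Store.setCoords, hi]
  · rintro _ rfl
    exact hQ

/-- Copy a point. -/
def copyPt (c : ℕ) (a : NExpr) (c' : ℕ) (a' : NExpr) : Program :=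
  unroll (fun i => .setReal (c * d + i) a (.cell (c' * d + i) a')) d

theorem Runs.copyPt {c c' : ℕ} {a a' : NExpr}
    (h : Q (σ.setPt d c (a.eval σ) (σ.pt d c' (a'.eval σ)))) : Runs N (copyPt d c a c' a') σ Q := by
  refine .coords d (fun i hi τ h₁ h₂ => .setReal ?_) h
  simp [RExpr.eval, NExpr.eval_congr h₁, h₂, Store.pt]

/-- Compute the distance of two points of array `4` in the real variable `1`. -/
def distance (a b : NExpr) : Program :=
  .seq (.setReal (6 * d + 1) (.const 0) (.const 0)) (unroll (fun i =>
    .cond (.realLe (.cell (4 * d + i) a) (.cell (4 * d + i) b))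
      (.setReal (6 * d + 1) (.const 0) (.add (.cell (6 * d + 1) (.const 0))
        (.sub (.cell (4 * d + i) b) (.cell (4 * d + i) a))))
      (.setReal (6 * d + 1) (.const 0) (.add (.cell (6 * d + 1) (.const 0))
        (.sub (.cell (4 * d + i) a) (.cell (4 * d + i) b))))) d)

theorem Runs.distance {a b : NExpr}
    (h : Q (σ.setScal d 1 (manhattanDist (σ.pt d 4 (a.eval σ)) (σ.pt d 4 (b.eval σ))))) :
    Runs N (distance d a b) σ Q := by
  refine .seq (.setReal ?_)
  let g : ℕ → ℝ := fun i => |σ.real (4 * d + i) (a.eval σ) - σ.real (4 * d + i) (b.eval σ)|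
  refine .iter (fun i τ => τ = σ.setScal d 1 (∑ j ∈ Finset.range i, g j)) ?_ ?_ ?_
  · simp [RExpr.eval, Store.setScal]
  · rintro i hi _ rfl
    have hn : (σ.setScal d 1 (∑ j ∈ Finset.range i, g j)).nat = σ.nat := rfl
    have hr : ∀ k, (σ.setScal d 1 (∑ j ∈ Finset.range i, g j)).real (4 * d + i) k =
        σ.real (4 * d + i) k := by
      intro k
      have := Store.bank_lt (c := 4) (by norm_num) hi
      rw [Store.setScal, Store.real_setReal, if_neg (by omega)]
    have hs : (σ.setScal d 1 (∑ j ∈ Finset.range i, g j)).real (6 * d + 1) 0 =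
        ∑ j ∈ Finset.range i, g j := by
      rw [Store.setScal, Store.real_setReal, if_pos ⟨rfl, rfl⟩]
    refine .cond (fun hc => .setReal ?_) (fun hc => .setReal ?_)
    · simp only [Test.Holds, RExpr.eval, NExpr.eval_congr hn, hr] at hc
      simp only [RExpr.eval, NExpr.eval_congr hn, hr, eval_const, hs, Finset.sum_range_succ]
      rw [← Store.setScal, Store.setScal_setScal]
      simp only [g]
      rw [abs_of_nonpos (by linarith), neg_sub]
    · simp only [Test.Holds, RExpr.eval, NExpr.eval_congr hn, hr] at hc
      simp only [RExpr.eval, NExpr.eval_congr hn, hr, eval_const, hs, Finset.sum_range_succ]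
      rw [← Store.setScal, Store.setScal_setScal]
      simp only [g]
      rw [abs_of_nonneg (by linarith)]
  · rintro _ rfl
    rw [Finset.sum_range]
    exact h

/-- Compute in point `2` of array `5` the median of two points of array `4` and point `1` of
array `5`. -/
def median (a b : NExpr) : Program :=
  unroll (fun i =>
    let A : RExpr := .cell (4 * d + i) a
    let B : RExpr := .cell (4 * d + i) b
    let S : RExpr := .cell (5 * d + i) (.const 1)
    let put : RExpr → Program := .setReal (5 * d + i) (.const 2)
    .cond (.realLe A B)
      (.cond (.realLe B S) (put B) (.cond (.realLe S A) (put A) (put S)))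
      (.cond (.realLe A S) (put A) (.cond (.realLe S B) (put B) (put S)))) d

/-- The nested tests follow the case distinction in `medR`, so each branch settles by its own test
outcomes. -/
theorem Runs.median {a b : NExpr}
    (h : Q (σ.setPt d 5 2 (med (σ.pt d 5 1) (σ.pt d 4 (a.eval σ)) (σ.pt d 4 (b.eval σ))))) :
    Runs N (median d a b) σ Q := by
  refine .coords d (fun i hi τ h₁ h₂ => ?_) h
  have ha := NExpr.eval_congr h₁ a
  have hb := NExpr.eval_congr h₁ b
  simp only [med, medR, Store.pt, ← h₂, ← ha, ← hb]
  refine .cond (fun c₁ => ?_) (fun c₁ => ?_) <;> simp only [Test.Holds, RExpr.eval] at c₁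
  · refine .cond (fun c₂ => .setReal ?_) (fun c₂ => ?_) <;>
      simp only [Test.Holds, RExpr.eval, eval_const] at c₂
    · simp [c₁, c₂, RExpr.eval]
    · refine .cond (fun c₃ => .setReal ?_) (fun c₃ => .setReal ?_) <;>
        simp only [Test.Holds, RExpr.eval, eval_const] at c₃ <;> simp [c₁, c₂, c₃, RExpr.eval]
  · refine .cond (fun c₂ => .setReal ?_) (fun c₂ => ?_) <;>
      simp only [Test.Holds, RExpr.eval, eval_const] at c₂
    · simp [c₁, c₂, RExpr.eval]
    · refine .cond (fun c₃ => .setReal ?_) (fun c₃ => .setReal ?_) <;>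
        simp only [Test.Holds, RExpr.eval, eval_const] at c₃ <;> simp [c₁, c₂, c₃, RExpr.eval]

/-- Compute in point `1` of array `5` the coordinatewise minimum of the first terminal pair. -/
def initSep : Program :=
  unroll (fun i => .cond (.realLe (.cell (0 * d + i) (.const 0)) (.cell (1 * d + i) (.const 0)))
    (.setReal (5 * d + i) (.const 1) (.cell (0 * d + i) (.const 0)))
    (.setReal (5 * d + i) (.const 1) (.cell (1 * d + i) (.const 0)))) d

theorem Runs.initSep (h : Q (σ.setPt d 5 1 fun i => min (σ.pt d 0 0 i) (σ.pt d 1 0 i))) :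
    Runs N (initSep d) σ Q := by
  refine .coords d (fun i hi τ h₁ h₂ => ?_) h
  simp only [Store.pt, ← h₂]
  refine .cond (fun c₁ => .setReal ?_) (fun c₁ => .setReal ?_) <;>
    simp only [Test.Holds, RExpr.eval, eval_const] at c₁
  · simp only [RExpr.eval, eval_const, min_eq_left c₁]
  · simp only [RExpr.eval, eval_const, min_eq_right (not_le.1 c₁).le]

/-- Update point `1` of array `5` with the terminal pair `a`. -/
def updateSep (a : NExpr) : Program :=
  unroll (fun i =>
    let A : RExpr := .cell (0 * d + i) a
    let B : RExpr := .cell (1 * d + i) a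
    let S : RExpr := .cell (5 * d + i) (.const 1)
    let put : RExpr → Program := .setReal (5 * d + i) (.const 1)
    .cond (.realLe A B) (.cond (.realLe S A) (put A) (put S))
      (.cond (.realLe S B) (put B) (put S))) d

theorem Runs.updateSep {a : NExpr} (h : Q (σ.setPt d 5 1 fun i =>
      max (σ.pt d 5 1 i) (min (σ.pt d 0 (a.eval σ) i) (σ.pt d 1 (a.eval σ) i)))) :
    Runs N (updateSep d a) σ Q := by
  refine .coords d (fun i hi τ h₁ h₂ => ?_) h
  have ha := NExpr.eval_congr h₁ a
  simp only [Store.pt, ← h₂, ← ha]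
  refine .cond (fun c₁ => ?_) (fun c₁ => ?_) <;> simp only [Test.Holds, RExpr.eval] at c₁
  · rw [min_eq_left c₁]
    refine .cond (fun c₂ => .setReal ?_) (fun c₂ => .setReal ?_) <;>
      simp only [Test.Holds, RExpr.eval, eval_const] at c₂
    · simp only [RExpr.eval, eval_const, max_eq_right c₂]
    · simp only [RExpr.eval, eval_const, max_eq_left (not_le.1 c₂).le]
  · rw [min_eq_right (not_le.1 c₁).le]
    refine .cond (fun c₂ => .setReal ?_) (fun c₂ => .setReal ?_) <;>
      simp only [Test.Holds, RExpr.eval, eval_const] at c₂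
    · simp only [RExpr.eval, eval_const, max_eq_right c₂]
    · simp only [RExpr.eval, eval_const, max_eq_left (not_le.1 c₂).le]

end Blocks


/-! ### The output network as a function of the memory -/

section Output

variable {d : ℕ}

/-- The network written so far. -/
def out (d : ℕ) (σ : Store) : Network d :=
  (List.range (σ.v 1)).map fun k => (σ.pt d 2 k, σ.pt d 3 k)

theorem decodeOutput_eq_out (σ : Store) : decodeOutput d σ = out d σ := by
  refine List.ext_getElem (by simp [decodeOutput, out, Store.v]) fun k h₁ h₂ => ?_
  simp only [decodeOutput, out, List.getElem_ofFn, List.getElem_map, List.getElem_range]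
  rfl

theorem out_congr {σ τ : Store} (h₁ : τ.v 1 = σ.v 1) (h₂ : ∀ k, τ.pt d 2 k = σ.pt d 2 k)
    (h₃ : ∀ k, τ.pt d 3 k = σ.pt d 3 k) : out d τ = out d σ := by
  simp only [out, h₁, h₂, h₃]

theorem out_succ {σ τ : Store} {x y : Pt d} (h₁ : τ.v 1 = σ.v 1 + 1)
    (h₂ : ∀ k, τ.pt d 2 k = if k = σ.v 1 then x else σ.pt d 2 k)
    (h₃ : ∀ k, τ.pt d 3 k = if k = σ.v 1 then y else σ.pt d 3 k) :
    out d τ = out d σ ++ [(x, y)] := by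
  simp only [out, h₁, List.range_succ, List.map_append, List.map_cons, List.map_nil, h₂, h₃,
    if_true]
  congr 1
  refine List.map_congr_left fun k hk => ?_
  rw [if_neg (List.mem_range.1 hk).ne, if_neg (List.mem_range.1 hk).ne]

theorem pt_setReal (σ : Store) (c k : ℕ) (i : Fin d) (x : ℝ) (c' k' : ℕ) :
    (σ.setReal (c * d + i) k x).pt d c' k' =
      if c' = c ∧ k' = k then Function.update (σ.pt d c k) i x else σ.pt d c' k' := by
  ext j
  simp only [Store.pt, Store.real_setReal]
  by_cases h : c' = c ∧ k' = k
  · obtain ⟨rfl, rfl⟩ := h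
    by_cases hj : j = i
    · subst hj; simp
    · have : (j : ℕ) ≠ i := fun h => hj (Fin.ext h)
      simp [hj, this, Store.pt]
  · rw [if_neg h, if_neg]
    · rfl
    rintro ⟨h₁, h₂⟩
    exact h ⟨(Store.bank_eq j.2 i.2 h₁).1, h₂⟩

/-! ### Writing a path -/

/-- The point whose first `i` coordinates are those of `b` and whose other coordinates are those
of `a`. -/
def mix (a b : Pt d) (i : ℕ) : Pt d := fun j => if (j : ℕ) < i then b j else a j

theorem mix_succ (a b : Pt d) {i : ℕ} (hi : i < d) :
    mix a b (i + 1) = Function.update (mix a b i) ⟨i, hi⟩ (b ⟨i, hi⟩) := by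
  ext j
  by_cases h : j = ⟨i, hi⟩
  · subst h; simp [mix]
  · have : (j : ℕ) ≠ i := fun h' => h (Fin.ext h')
    rw [Function.update_of_ne h]
    simp only [mix]
    exact if_congr (by omega) rfl rfl

theorem mix_zero (a b : Pt d) : mix a b 0 = a := by ext j; simp [mix]

theorem mix_dim (a b : Pt d) : mix a b d = b := by ext j; simp [mix]

theorem axisParallel_mix (a b : Pt d) (i : ℕ) : AxisParallel (mix a b i) (mix a b (i + 1)) := by
  have : ∀ j : Fin d, mix a b i j ≠ mix a b (i + 1) j → (j : ℕ) = i := by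
    intro j hj
    by_contra h
    exact hj (if_congr (by omega) rfl rfl)
  exact fun j j' h h' => Fin.ext ((this j h).trans (this j' h').symm)

theorem btw_mix (a b : Pt d) (i : ℕ) : Btw a (mix a b i) (mix a b (i + 1)) := by
  refine btw_of_coord fun j => ?_
  simp only [mix]
  split_ifs <;> first | omega | simp

/-- `τ` differs from `σ` only in the output, in point `0` of array `5` and in real variables. -/
def Keeps (d : ℕ) (σ τ : Store) : Prop :=
  (∀ b, b ≠ 1 → τ.v b = σ.v b) ∧ (∀ k, τ.pt d 4 k = σ.pt d 4 k) ∧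
    ∀ k, k ≠ 0 → τ.pt d 5 k = σ.pt d 5 k

variable (d)

/-- Write an axis-parallel path from point `0` to point `2` of array `5`. -/
def emitPath : Program :=
  unroll (fun i =>
    .seq (copyPt d 2 (var 1) 5 (.const 0)) <|
    .seq (.setReal (5 * d + i) (.const 0) (.cell (5 * d + i) (.const 2))) <|
    .seq (copyPt d 3 (var 1) 5 (.const 0)) <|
    assign 1 (.add (var 1) (.const 1))) d

variable {d}

/-- One coordinate at a time is changed from its start to its target value, possibly by degenerate
segments; each change moves monotonically, so the path is Manhattan. That the start is already
covered settles the case of no segments. -/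
theorem Runs.emitPath {N : ℕ} {σ : Store} {Q : Store → Prop}
    (ha : σ.pt d 5 0 ∈ support (out d σ))
    (hQ : ∀ τ, Keeps d σ τ → ∀ S, out d τ = out d σ ++ S → IsRectilinear S →
      networkLength S = manhattanDist (σ.pt d 5 0) (σ.pt d 5 2) →
      MConnects (out d τ) (σ.pt d 5 0) (σ.pt d 5 2) → Q τ) : Runs N (emitPath d) σ Q := by
  set a := σ.pt d 5 0 with hadef
  set b := σ.pt d 5 2 with hbdef
  refine .iter (fun i τ => Keeps d σ τ ∧ τ.pt d 5 0 = mix a b i ∧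
    MConnects (out d τ) a (mix a b i) ∧ ∃ S, out d τ = out d σ ++ S ∧ IsRectilinear S ∧
      networkLength S = manhattanDist a (mix a b i)) ?_ ?_ ?_
  · refine ⟨⟨fun _ _ => rfl, fun _ => rfl, fun _ _ => rfl⟩, ?_, ?_, [], by simp, ?_, ?_⟩
    · rw [mix_zero]
    · rw [mix_zero]; exact mconnects_self ha
    · simp [IsRectilinear]
    · simp [networkLength, mix_zero]
  · rintro i hi τ ⟨⟨k₁, k₂, k₃⟩, hcur, hconn, S, hS, hrect, hlen⟩
    refine .seq (.copyPt d (.seq (.setReal (.seq (.copyPt d (.assign ?_))))))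
    have hb : τ.real (5 * d + i) 2 = b ⟨i, hi⟩ := by
      rw [hbdef, ← k₃ 2 (by norm_num)]; rfl
    have hb' : ∀ k x, (τ.setPt d 2 k x).real (5 * d + i) 2 = b ⟨i, hi⟩ := by
      intro k x
      have := Store.pt_setPt τ 2 k x 5 2
      rw [if_neg (by norm_num)] at this
      rw [← hb]
      exact congrFun this ⟨i, hi⟩
    have hset : ∀ (υ : Store) (x : ℝ) (c' k' : ℕ), (υ.setReal (5 * d + i) 0 x).pt d c' k' =
      if c' = 5 ∧ k' = 0 then Function.update (υ.pt d 5 0) ⟨i, hi⟩ x else υ.pt d c' k' :=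
      fun υ x c' k' => pt_setReal υ 5 0 ⟨i, hi⟩ x c' k'
    simp only [eval_var, eval_const, eval_add, RExpr.eval, Store.v_setPt, Store.v_setReal, hb']
    generalize hυ : Store.setV _ _ _ = υ
    have hout : out d υ = out d τ ++ [(mix a b i, mix a b (i + 1))] := by
      subst hυ
      refine out_succ ?_ ?_ ?_
      · simp [Store.v_setV]
      · intro k; simp [Store.pt_setPt, hset, hcur]
      · intro k; simp [Store.pt_setPt, hset, hcur, mix_succ a b hi]
    have hconn' : MConnects (out d υ) (mix a b i) (mix a b (i + 1)) := by
      refine mconnects_of_segment_subset (axisParallel_mix a b i) fun z hz => ?_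
      exact ⟨(mix a b i, mix a b (i + 1)), by rw [hout]; simp, hz⟩
    refine ⟨⟨?_, ?_, ?_⟩, ?_, ?_, S ++ [(mix a b i, mix a b (i + 1))], ?_, ?_, ?_⟩
    · intro b hb; subst hυ; simp [Store.v_setV, hb, k₁ b hb]
    · intro k; subst hυ; simp [Store.pt_setPt, hset, k₂ k]
    · intro k hk; subst hυ; simp [Store.pt_setPt, hset, hk, k₃ k hk]
    · subst hυ; simp [Store.pt_setPt, hset, hcur, mix_succ a b hi]
    · exact MConnects.trans (by rw [hout]; exact hconn.append _) hconn' (btw_mix a b i)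
    · rw [hout, hS, List.append_assoc]
    · intro e he
      rcases List.mem_append.1 he with he | he
      · exact hrect e he
      · simp at he; subst he; exact axisParallel_mix a b i
    · rw [networkLength_append, hlen, ← btw_mix a b i]
      simp [networkLength]
  · rintro τ ⟨hk, _, hconn, S, h₁, h₂, h₃⟩
    rw [mix_dim] at hconn h₃
    exact hQ τ hk S h₁ h₂ h₃ hconn

end Output


section Merge

variable (d : ℕ)

/-! ### Merging consecutive points -/

/-- Merge two consecutive points, starting with number `var 9`, into point number `var 8`. -/
def mergeStep : Program :=
  .seq (median d (var 9) (.add (var 9) (.const 1))) <|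
  .seq (copyPt d 5 (.const 0) 4 (var 9)) <|
  .seq (emitPath d) <|
  .seq (copyPt d 5 (.const 0) 4 (.add (var 9) (.const 1))) <|
  .seq (emitPath d) <|
  .seq (copyPt d 4 (var 8) 5 (.const 2)) <|
  .seq (assign 8 (.add (var 8) (.const 1)))
    (assign 9 (.add (var 9) (.const 2)))

/-- One round of merging. -/
def mergeRoundProg : Program :=
  .seq (assign 8 (.const 0)) <|
  .seq (assign 9 (.const 0)) <|
  .seq (.loop (lt (.add (var 9) (.const 1)) (var 2)) (mergeStep d)) <|
  .seq (.cond (lt (var 9) (var 2))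
    (.seq (copyPt d 4 (var 8) 4 (var 9)) (assign 8 (.add (var 8) (.const 1)))) .nop)
    (assign 2 (var 8))

/-- Merge until one point is left. -/
def mergeAll : Program := .loop (lt (.const 1) (var 2)) (mergeRoundProg d)

variable {d} {N : ℕ} {σ : Store} {Q : Store → Prop}

/-- Both legs to the median are written; as the median lies between the two points, their total
length is exactly the distance of the points. -/
theorem Runs.mergeStep
    (ha : σ.pt d 4 (σ.v 9) ∈ support (out d σ))
    (hb : σ.pt d 4 (σ.v 9 + 1) ∈ support (out d σ))
    (hQ : ∀ τ, (∀ b, b ≠ 1 → τ.v b = if b = 8 then σ.v 8 + 1 else if b = 9 then σ.v 9 + 2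
        else σ.v b) → τ.pt d 5 1 = σ.pt d 5 1 →
      (∀ k, τ.pt d 4 k = if k = σ.v 8 then
        med (σ.pt d 5 1) (σ.pt d 4 (σ.v 9)) (σ.pt d 4 (σ.v 9 + 1)) else σ.pt d 4 k) →
      ∀ S, out d τ = out d σ ++ S → IsRectilinear S →
      networkLength S = manhattanDist (σ.pt d 4 (σ.v 9)) (σ.pt d 4 (σ.v 9 + 1)) →
      MConnects (out d τ) (σ.pt d 4 (σ.v 9))
        (med (σ.pt d 5 1) (σ.pt d 4 (σ.v 9)) (σ.pt d 4 (σ.v 9 + 1))) →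
      MConnects (out d τ) (σ.pt d 4 (σ.v 9 + 1))
        (med (σ.pt d 5 1) (σ.pt d 4 (σ.v 9)) (σ.pt d 4 (σ.v 9 + 1))) → Q τ) :
    Runs N (mergeStep d) σ Q := by
  set a := σ.pt d 4 (σ.v 9) with hadef
  set b := σ.pt d 4 (σ.v 9 + 1) with hbdef
  set c := med (σ.pt d 5 1) a b with hcdef
  refine .seq (.median d (.seq (.copyPt d (.seq ?_))))
  simp only [eval_var, eval_const, eval_add, Store.v_setPt, ← hadef, ← hbdef, ← hcdef]
  generalize hσ₁ : Store.setPt d _ 5 0 _ = σ₁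
  have e₁ : out d σ₁ = out d σ := by
    subst hσ₁
    exact out_congr (by simp) (by simp [Store.pt_setPt]) (by simp [Store.pt_setPt])
  have f₀ : σ₁.pt d 5 0 = a := by subst hσ₁; simp [Store.pt_setPt, ← hadef]
  have f₁ : σ₁.pt d 5 1 = σ.pt d 5 1 := by subst hσ₁; simp [Store.pt_setPt]
  have f₂ : σ₁.pt d 5 2 = c := by subst hσ₁; simp [Store.pt_setPt]
  have f₄ : ∀ k, σ₁.pt d 4 k = σ.pt d 4 k := by intro k; subst hσ₁; simp [Store.pt_setPt]
  have fv : ∀ b, σ₁.v b = σ.v b := by intro k; subst hσ₁; simp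
  clear hσ₁
  refine .emitPath (by rwa [f₀, e₁]) ?_
  rw [f₀, f₂, e₁]
  intro τ₁ ⟨k₁, k₂, k₃⟩ S₁ hS₁ hr₁ hl₁ hc₁
  refine .seq (.copyPt d (.seq ?_))
  have g₄ : ∀ k, τ₁.pt d 4 k = σ.pt d 4 k := fun k => (k₂ k).trans (f₄ k)
  simp only [eval_var, eval_const, eval_add, k₁ 9 (by norm_num), fv, g₄, ← hbdef]
  generalize hσ₂ : Store.setPt d _ 5 0 _ = σ₂
  have e₂ : out d σ₂ = out d σ ++ S₁ := by
    rw [← hS₁]; subst hσ₂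
    exact out_congr (by simp) (by simp [Store.pt_setPt]) (by simp [Store.pt_setPt])
  have h₀ : σ₂.pt d 5 0 = b := by subst hσ₂; simp [Store.pt_setPt]
  have h₁ : σ₂.pt d 5 1 = σ.pt d 5 1 := by
    subst hσ₂; simp [Store.pt_setPt, k₃ 1 (by norm_num), f₁]
  have h₂ : σ₂.pt d 5 2 = c := by
    subst hσ₂; simp [Store.pt_setPt, k₃ 2 (by norm_num), f₂]
  have h₄ : ∀ k, σ₂.pt d 4 k = σ.pt d 4 k := by intro k; subst hσ₂; simp [Store.pt_setPt, g₄]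
  have hv : ∀ b, b ≠ 1 → σ₂.v b = σ.v b := by
    intro k hk; subst hσ₂; simp [k₁ k hk, fv]
  clear hσ₂
  refine .emitPath (by rw [h₀, e₂, support_append]; exact Or.inl hb) ?_
  rw [h₀, h₂, e₂]
  intro τ₂ ⟨l₁, l₂, l₃⟩ S₂ hS₂ hr₂ hl₂ hc₂
  refine .seq (.copyPt d (.seq (.assign (.assign ?_))))
  simp only [eval_var, eval_const, eval_add, Store.v_setV, Store.v_setPt, l₁ 8 (by norm_num),
    l₁ 9 (by norm_num), hv 8 (by norm_num), hv 9 (by norm_num), l₃ 2 (by norm_num), h₂]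
  generalize hτ : Store.setV _ 9 _ = τ
  have e₃ : out d τ = out d σ ++ S₁ ++ S₂ := by
    rw [← hS₂]; subst hτ
    exact out_congr (by simp [Store.v_setV]) (by simp [Store.pt_setPt]) (by simp [Store.pt_setPt])
  rw [← hS₁] at e₃
  refine hQ τ ?_ ?_ ?_ (S₁ ++ S₂) (by rw [e₃, hS₁, List.append_assoc]) ?_ ?_ ?_ ?_
  · intro b hb
    subst hτ
    simp only [Store.v_setV, Store.v_setPt, l₁ b hb, hv b hb]
    split_ifs <;> first | rfl | omega
  · subst hτ; simp [Store.pt_setPt, l₃, h₁]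
  · intro k; subst hτ; simp [Store.pt_setPt, l₂, h₄]
  · intro e he
    rcases List.mem_append.1 he with he | he
    exacts [hr₁ e he, hr₂ e he]
  · rw [networkLength_append, hl₁, hl₂, manhattanDist_comm b c]
    exact btw_med _ a b
  · rw [e₃]; exact hc₁.append _
  · rw [e₃, hS₁, ← hS₂]; exact hc₂

/-- The state between two rounds of merging: `D` is the set of original points. -/
structure MergeInv (s : Pt d) (D : Set (Pt d)) (σ : Store) : Prop where
  sep : σ.pt d 5 1 = s
  root : σ.pt d 4 0 = s
  pos : 0 < σ.v 2
  mem : ∀ i < σ.v 2, σ.pt d 4 i ∈ support (out d σ)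
  reach : ∀ p ∈ D, ∃ i < σ.v 2, MConnects (out d σ) p (σ.pt d 4 i) ∧ Btw p (σ.pt d 4 i) s
  rect : IsRectilinear (out d σ)

theorem Runs.mergeRoundProg {s : Pt d} {D : Set (Pt d)} (h : MergeInv s D σ) (hN : σ.v 2 ≤ N)
    (hQ : ∀ τ, MergeInv s D τ → τ.v 2 = (σ.v 2 + 1) / 2 →
      pathLength (arr (τ.pt d 4) (τ.v 2)) ≤ pathLength (arr (σ.pt d 4) (σ.v 2)) →
      networkLength (out d τ) ≤
        networkLength (out d σ) + pathLength (arr (σ.pt d 4) (σ.v 2)) → Q τ) :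
    Runs N (mergeRoundProg d) σ Q := by
  set X := σ.pt d 4 with hX
  set m := σ.v 2 with hm
  obtain ⟨hsep, hroot, hpos, hmem, hreach, hrect⟩ := h
  refine .seq (.assign (.seq (.assign (.seq ?_))))
  -- The round works in place: cells below `q` hold medians, cells from `2 * q` on are pending, and
  -- those in between are stale. Every original point is tracked to a live cell.
  refine .loop (fun q τ => τ.v 8 = q ∧ τ.v 9 = 2 * q ∧ τ.v 2 = m ∧ 2 * q ≤ m ∧ τ.pt d 5 1 = s ∧
    (∀ q' < q, τ.pt d 4 q' = med s (X (2 * q')) (X (2 * q' + 1))) ∧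
    (∀ j, 2 * q ≤ j → τ.pt d 4 j = X j) ∧
    IsRectilinear (out d τ) ∧
    networkLength (out d τ) = networkLength (out d σ) +
      ∑ q' ∈ Finset.range q, manhattanDist (X (2 * q')) (X (2 * q' + 1)) ∧
    (∀ i, (i < q ∨ (2 * q ≤ i ∧ i < m)) → τ.pt d 4 i ∈ support (out d τ)) ∧
    ∀ p ∈ D, ∃ i, (i < q ∨ (2 * q ≤ i ∧ i < m)) ∧ MConnects (out d τ) p (τ.pt d 4 i) ∧
      Btw p (τ.pt d 4 i) s) ?_ ?_ ?_
  · have e : out d ((σ.setV 8 0).setV 9 0) = out d σ :=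
      out_congr (by simp [Store.v_setV]) (by simp) (by simp)
    simp only [eval_const, e, Store.pt_setV, ← hX]
    refine ⟨by simp [Store.v_setV], by simp [Store.v_setV], by simp [Store.v_setV, hm], by simp,
      hsep, by simp, by simp, hrect, by simp, ?_, ?_⟩
    · intro i hi
      exact hmem i (by omega)
    · intro p hp
      obtain ⟨i, hi, h⟩ := hreach p hp
      exact ⟨i, by omega, h⟩
  · rintro q τ ⟨h8, h9, h2, hq, hs, hdone, htodo, hrect, hlen, hmem, hreach⟩ hc
    rw [holds_lt] at hc
    simp only [eval_var, eval_add, eval_const, h9, h2] at hc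
    refine ⟨by omega, ?_⟩
    have h₀ := htodo (2 * q) le_rfl
    have h₁ := htodo (2 * q + 1) (by omega)
    refine .mergeStep (by rw [h9]; exact hmem _ (by omega)) (by rw [h9]; exact hmem _ (by omega)) ?_
    rw [h9, h8, h₀, h₁, hs]
    set c := med s (X (2 * q)) (X (2 * q + 1)) with hcdef
    intro υ hv hs' hX' S hS hSr hSl hca hcb
    have hsub : ∀ x, x ∈ support (out d τ) → x ∈ support (out d υ) := by
      intro x hx; rw [hS, support_append]; exact Or.inl hx
    refine ⟨by simp [hv 8], by simp [hv 9]; omega, by simp [hv 2, h2], by omega, hs', ?_, ?_, ?_,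
      ?_, ?_, ?_⟩
    · intro q' hq'
      rw [hX']
      by_cases h : q' = q
      · subst h; simp [hcdef]
      · rw [if_neg h, hdone q' (by omega)]
    · intro j hj
      rw [hX', if_neg (by omega), htodo j (by omega)]
    · rw [hS]
      intro e he
      rcases List.mem_append.1 he with he | he
      exacts [hrect e he, hSr e he]
    · rw [hS, networkLength_append, hlen, hSl, Finset.sum_range_succ, add_assoc]
    · intro i hi
      rw [hX']
      split_ifs with h
      · exact hca.right_mem
      · exact hsub _ (hmem i (by omega))
    · intro p hp
      obtain ⟨i, hi, hpi, hbtw⟩ := hreach p hp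
      have hpi' : MConnects (out d υ) p (τ.pt d 4 i) := by rw [hS]; exact hpi.append _
      by_cases hi0 : i = 2 * q
      · subst hi0
        rw [h₀] at hpi' hbtw
        have hb : Btw (X (2 * q)) c s := btw_med_left _ _ _
        exact ⟨q, by omega, by rw [hX', if_pos rfl]; exact hpi'.trans hca (hbtw.left hb),
          by rw [hX', if_pos rfl]; exact hbtw.trans hb⟩
      by_cases hi1 : i = 2 * q + 1
      · subst hi1
        rw [h₁] at hpi' hbtw
        have hb : Btw (X (2 * q + 1)) c s := btw_med_right _ _ _
        exact ⟨q, by omega, by rw [hX', if_pos rfl]; exact hpi'.trans hcb (hbtw.left hb),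
          by rw [hX', if_pos rfl]; exact hbtw.trans hb⟩
      · refine ⟨i, by omega, ?_⟩
        rw [hX', if_neg (by omega)]
        exact ⟨hpi', hbtw⟩
  · rintro q τ ⟨h8, h9, h2, hq, hs, hdone, htodo, hrect, hlen, hmem, hreach⟩ hc
    rw [holds_lt] at hc
    simp only [eval_var, eval_add, eval_const, h9, h2] at hc
    have hlen' : networkLength (out d τ) ≤ networkLength (out d σ) + pathLength (arr X m) := by
      rw [hlen, show q = m / 2 by omega, sum_pairs_eq_pairCost]
      have := pairCost_le_pathLength (arr X m)
      linarith
    -- Common end of the round for even and odd `m`; for odd `m`, the leftover point has moved from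
    -- cell `2 * q` to cell `q`.
    have hfin : ∀ υ : Store, υ.v 2 = (m + 1) / 2 → υ.v 1 = τ.v 1 → υ.pt d 5 1 = s →
        (∀ c, c = 2 ∨ c = 3 → ∀ k, υ.pt d c k = τ.pt d c k) →
        (∀ q' < q, υ.pt d 4 q' = τ.pt d 4 q') →
        (2 * q + 1 = m → υ.pt d 4 q = τ.pt d 4 (2 * q)) → Q υ := by
      intro υ hv2 hv1 hs' hout hlow hlast
      have e : out d υ = out d τ := out_congr hv1 (hout 2 (Or.inl rfl)) (hout 3 (Or.inr rfl))
      have hidx : ∀ i, (i < q ∨ (2 * q ≤ i ∧ i < m)) →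
          ∃ i' < (m + 1) / 2, υ.pt d 4 i' = τ.pt d 4 i := by
        rintro i (hi | hi)
        · exact ⟨i, by omega, hlow i hi⟩
        · obtain rfl : i = 2 * q := by omega
          exact ⟨q, by omega, hlast (by omega)⟩
      have harr : arr (υ.pt d 4) ((m + 1) / 2) = mergeRound s (arr X m) := by
        refine arr_mergeRound s m X _ (fun q' hq' => ?_) (fun q' hq' => ?_)
        · rw [hlow q' (by omega), hdone q' (by omega)]
        · obtain rfl : q' = q := by omega
          rw [hlast hq', htodo _ le_rfl]
      refine hQ υ ⟨hs', ?_, by omega, ?_, ?_, by rwa [e]⟩ hv2 ?_ (by rwa [e])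
      -- If no pair was merged, then `m = 1` and the leftover point is the root itself.
      · by_cases hq0 : q = 0
        · subst hq0
          rw [hlast (by omega), htodo _ le_rfl, mul_zero, hX, hroot]
        · rw [hlow 0 (by omega), hdone 0 (by omega), mul_zero, hX, hroot, med_self]
      · intro i hi
        rw [e]
        by_cases hiq : i < q
        · rw [hlow i hiq]; exact hmem i (Or.inl hiq)
        · obtain rfl : i = q := by omega
          rw [hlast (by omega)]; exact hmem _ (by omega)
      · intro p hp
        obtain ⟨i, hi, h₁, h₂⟩ := hreach p hp
        obtain ⟨i', hi', hii⟩ := hidx i hi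
        exact ⟨i', by omega, by rw [e, hii]; exact h₁, by rw [hii]; exact h₂⟩
      · rw [hv2, harr]; exact (pathLength_mergeRound_le s _).1
    refine .seq (.cond (fun hc => .seq (.copyPt d (.assign (.assign ?_))))
      (fun hc => .nop (.assign ?_))) <;>
      rw [holds_lt] at hc <;> simp only [eval_var, h9, h2] at hc
    · refine hfin _ ?_ ?_ ?_ ?_ ?_ ?_
      · simp [Store.v_setV, h8]; omega
      · simp [Store.v_setV]
      · simp [Store.pt_setPt, hs]
      · rintro c (rfl | rfl) k <;> simp [Store.pt_setPt]
      · intro q' hq'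
        simp only [Store.pt_setV, Store.pt_setPt, eval_var, h8]
        rw [if_neg (by omega)]
      · intro _
        simp [Store.pt_setPt, h8, h9]
    · refine hfin _ ?_ ?_ ?_ ?_ ?_ ?_
      · simp [Store.v_setV, h8]; omega
      · simp [Store.v_setV]
      · simp [hs]
      · simp
      · simp
      · intro _; omega

/-- The potential, length written plus `clog` of the number of points times `L`, never increases: a
round writes at most `L` and lowers the `clog` by one. Each round also loses a point, which bounds
the number of rounds. -/
theorem Runs.mergeAll {s : Pt d} {D : Set (Pt d)} (h : MergeInv s D σ) (hN : σ.v 2 ≤ N)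
    (hQ : ∀ τ, IsRectilinear (out d τ) → (∀ p ∈ D, MConnects (out d τ) p s) →
      networkLength (out d τ) ≤
        networkLength (out d σ) + Nat.clog 2 (σ.v 2) * pathLength (arr (σ.pt d 4) (σ.v 2)) → Q τ) :
    Runs N (mergeAll d) σ Q := by
  set L := pathLength (arr (σ.pt d 4) (σ.v 2)) with hL
  have hL0 : 0 ≤ L := pathLength_nonneg _
  refine .loop (fun k τ => MergeInv s D τ ∧ τ.v 2 + k ≤ σ.v 2 ∧
    pathLength (arr (τ.pt d 4) (τ.v 2)) ≤ L ∧ networkLength (out d τ) +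
      Nat.clog 2 (τ.v 2) * L ≤ networkLength (out d σ) + Nat.clog 2 (σ.v 2) * L) ?_ ?_ ?_
  · exact ⟨h, by simp, le_rfl, le_rfl⟩
  · rintro k τ ⟨hI, hk, hp, hl⟩ hc
    rw [holds_lt] at hc
    simp only [eval_const, eval_var] at hc
    refine ⟨by omega, .mergeRoundProg hI (by omega) fun υ hI' h2 hp' hl' => ⟨hI', by omega,
      hp'.trans hp, ?_⟩⟩
    have : Nat.clog 2 (τ.v 2) = Nat.clog 2 (υ.v 2) + 1 := by
      rw [Nat.clog_of_two_le (by norm_num) hc, h2]; rfl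
    rw [this, Nat.cast_add, Nat.cast_one, add_mul, one_mul] at hl
    linarith
  · rintro k τ ⟨hI, hk, hp, hl⟩ hc
    rw [holds_lt] at hc
    simp only [eval_const, eval_var] at hc
    refine hQ τ hI.rect (fun p hp => ?_) ?_
    · obtain ⟨i, hi, hconn, _⟩ := hI.reach p hp
      obtain rfl : i = 0 := by omega
      rwa [hI.root] at hconn
    · have : 0 ≤ (Nat.clog 2 (τ.v 2) : ℝ) * L := mul_nonneg (Nat.cast_nonneg _) hL0
      linarith

end Merge


section Ordering

variable (d : ℕ)

/-! ### Ordering the points -/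

/-- The body of the search for a closest pair. -/
def searchStep : Program :=
  .seq (distance d (var 4) (var 5)) <|
  .seq (.cond (.realLe (.cell (6 * d + 1) (.const 0)) (.cell (6 * d + 0) (.const 0)))
    (.seq (assign 6 (var 4)) <| .seq (assign 7 (var 5))
      (.setReal (6 * d + 0) (.const 0) (.cell (6 * d + 1) (.const 0)))) .nop)
    (assign 5 (.add (var 5) (.const 1)))

/-- Find `var 6 < var 3 ≤ var 7 < var 2` such that the points with these numbers are as close as
possible. -/
def search : Program :=
  .seq (assign 6 (.const 0)) <|
  .seq (assign 7 (var 3)) <|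
  .seq (distance d (.const 0) (var 3)) <|
  .seq (.setReal (6 * d + 0) (.const 0) (.cell (6 * d + 1) (.const 0))) <|
  .seq (assign 4 (.const 0)) <|
  .loop (lt (var 4) (var 3)) <|
    .seq (assign 5 (var 3)) <|
    .seq (.loop (lt (var 5) (var 2)) (searchStep d))
      (assign 4 (.add (var 4) (.const 1)))

/-- Move the point number `var 7` right behind the point number `var 6`. -/
def rotate : Program :=
  .seq (copyPt d 5 (.const 0) 4 (var 7)) <|
  .seq (assign 8 (var 7)) <|
  .seq (.loop (lt (.add (var 6) (.const 1)) (var 8))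
    (.seq (copyPt d 4 (var 8) 4 (.sub (var 8) (.const 1)))
      (assign 8 (.sub (var 8) (.const 1)))))
    (copyPt d 4 (var 8) 5 (.const 0))

/-- Order the points along a short path. -/
def order : Program :=
  .seq (assign 3 (.const 1)) <|
  .loop (lt (var 3) (var 2)) <|
    .seq (search d) <| .seq (rotate d) (assign 3 (.add (var 3) (.const 1)))

variable {d} {N : ℕ} {σ : Store} {Q : Store → Prop}

/-- The state of the search: `var 6` and `var 7` are a closest pair among the pairs up to
`(i, j)`. -/
structure SearchInv (σ : Store) (i j : ℕ) (τ : Store) : Prop where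
  var_eq : ∀ b < 4, τ.v b = σ.v b
  pt_eq : ∀ c < 6, ∀ k, τ.pt d c k = σ.pt d c k
  lt₁ : τ.v 6 < σ.v 3
  le₂ : σ.v 3 ≤ τ.v 7
  lt₂ : τ.v 7 < σ.v 2
  best : τ.scal d 0 = manhattanDist (σ.pt d 4 (τ.v 6)) (σ.pt d 4 (τ.v 7))
  min : ∀ i' < σ.v 3, ∀ j', σ.v 3 ≤ j' → j' < σ.v 2 → (i' < i ∨ (i' = i ∧ j' < j)) →
    τ.scal d 0 ≤ manhattanDist (σ.pt d 4 i') (σ.pt d 4 j')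

/-- Pairs are scanned in lexicographic order. Starting with the actual pair `(0, var 3)` makes an
infinite initial minimum unnecessary. -/
theorem Runs.search (h₁ : 0 < σ.v 3) (h₂ : σ.v 3 < σ.v 2) (hN : σ.v 2 ≤ N)
    (hQ : ∀ τ, (∀ b < 4, τ.v b = σ.v b) → (∀ c < 6, ∀ k, τ.pt d c k = σ.pt d c k) →
      τ.v 6 < σ.v 3 → σ.v 3 ≤ τ.v 7 → τ.v 7 < σ.v 2 →
      (∀ i < σ.v 3, ∀ j, σ.v 3 ≤ j → j < σ.v 2 →
        manhattanDist (σ.pt d 4 (τ.v 6)) (σ.pt d 4 (τ.v 7)) ≤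
          manhattanDist (σ.pt d 4 i) (σ.pt d 4 j)) → Q τ) : Runs N (search d) σ Q := by
  refine .seq (.assign (.seq (.assign (.seq (.distance d (.seq (.setReal
    (.seq (.assign ?_)))))))))
  refine .loop (fun i τ => τ.v 4 = i ∧ i ≤ σ.v 3 ∧ SearchInv (d := d) σ i (σ.v 3) τ) ?_ ?_ ?_
  · simp only [eval_const, eval_var, RExpr.eval]
    rw [← Store.setScal, ← Store.scal]
    refine ⟨by simp [Store.v_setV], by simp, ⟨?_, ?_, ?_, ?_, ?_, ?_, ?_⟩⟩
    · intro b hb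
      simp only [Store.v_setV, Store.v_setScal]
      split_ifs <;> omega
    · intro c hc k
      simp [Store.pt_setScal _ _ _ hc]
    · simpa [Store.v_setV] using h₁
    · simp [Store.v_setV]
    · simpa [Store.v_setV] using h₂
    · simp [Store.v_setV, Store.scal_setScal]
    · intro i' hi' j' hj hj' h; omega
  · rintro i τ ⟨hv4, hi, hI⟩ hc
    rw [holds_lt] at hc
    simp only [eval_var, hv4, hI.var_eq 3 (by norm_num)] at hc
    refine ⟨by omega, .seq (.assign (.seq ?_))⟩
    simp only [eval_var, hI.var_eq 3 (by norm_num)]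
    refine .loop (fun a υ => υ.v 4 = i ∧ υ.v 5 = σ.v 3 + a ∧
      SearchInv (d := d) σ i (σ.v 3 + a) υ) ?_ ?_ ?_
    · refine ⟨by simp [Store.v_setV, hv4], by simp [Store.v_setV], ?_⟩
      obtain ⟨a₁, a₂, a₃, a₄, a₅, a₆, a₇⟩ := hI
      refine ⟨?_, a₂, ?_, ?_, ?_, ?_, a₇⟩
      · intro b hb; rw [Store.v_setV, if_neg (by omega), a₁ b hb]
      all_goals simpa [Store.v_setV]
    · rintro a υ ⟨hv4, hv5, hI⟩ hc
      rw [holds_lt] at hc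
      simp only [eval_var, hv5, hI.var_eq 2 (by norm_num)] at hc
      refine ⟨by omega, .seq (.distance d ?_)⟩
      obtain ⟨a₁, a₂, a₃, a₄, a₅, a₆, a₇⟩ := hI
      simp only [eval_var, hv4, hv5, a₂ 4 (by norm_num)]
      set δ := manhattanDist (σ.pt d 4 i) (σ.pt d 4 (σ.v 3 + a)) with hδ
      refine .seq (.cond (fun hle => .seq (.assign (.seq (.assign (.setReal (.assign ?_))))))
        (fun hle => .nop (.assign ?_)))
      · simp only [Test.Holds, RExpr.eval, eval_const] at hle
        rw [← Store.scal, ← Store.scal, Store.scal_setScal, Store.scal_setScal, if_pos rfl,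
          if_neg (by norm_num)] at hle
        simp only [RExpr.eval, eval_const, eval_var, eval_add, Store.v_setV, Store.v_setScal]
        rw [← Store.setScal, ← Store.scal]
        refine ⟨by simp [Store.v_setV, hv4], by simp [Store.v_setV, hv5, add_assoc],
          ⟨?_, ?_, ?_, ?_, ?_, ?_, ?_⟩⟩
        · intro b hb
          simp only [Store.v_setV, Store.v_setScal, a₁ b hb]
          split_ifs <;> omega
        · intro c hc k
          simp [Store.pt_setScal _ _ _ hc, a₂ c hc]
        · simpa [Store.v_setV, hv4]
        · simp [Store.v_setV, hv5]
        · simpa [Store.v_setV, hv5]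
        · simp [Store.v_setV, Store.scal_setScal, hv4, hv5, hδ]
        · intro i' hi' j' hj hj' h
          simp only [Store.scal_setV, Store.scal_setScal, if_true]
          by_cases hnew : i' = i ∧ j' = σ.v 3 + a
          · obtain ⟨rfl, rfl⟩ := hnew; exact le_rfl
          · exact hle.trans (a₇ i' hi' j' hj hj' (by omega))
      · simp only [Test.Holds, RExpr.eval, eval_const] at hle
        rw [← Store.scal, ← Store.scal, Store.scal_setScal, Store.scal_setScal, if_pos rfl,
          if_neg (by norm_num)] at hle
        refine ⟨by simp [Store.v_setV, hv4], by simp [Store.v_setV, hv5, add_assoc],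
          ⟨?_, ?_, ?_, ?_, ?_, ?_, ?_⟩⟩
        · intro b hb
          simp only [Store.v_setV, Store.v_setScal, a₁ b hb]
          split_ifs <;> omega
        · intro c hc k
          simp [Store.pt_setScal _ _ _ hc, a₂ c hc]
        · simpa [Store.v_setV]
        · simpa [Store.v_setV]
        · simpa [Store.v_setV]
        · simpa [Store.v_setV, Store.scal_setScal]
        · intro i' hi' j' hj hj' h
          rw [Store.scal_setV, Store.scal_setScal, if_neg (by norm_num)]
          by_cases hnew : i' = i ∧ j' = σ.v 3 + a
          · obtain ⟨rfl, rfl⟩ := hnew; exact (not_le.1 hle).le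
          · exact a₇ i' hi' j' hj hj' (by omega)
    · rintro a υ ⟨hv4, hv5, a₁, a₂, a₃, a₄, a₅, a₆, a₇⟩ hc
      rw [holds_lt] at hc
      simp only [eval_var, hv5, a₁ 2 (by norm_num)] at hc
      refine .assign ⟨by simp [Store.v_setV, hv4], by omega, ⟨?_, a₂, ?_, ?_, ?_, ?_, ?_⟩⟩
      · intro b hb; rw [Store.v_setV, if_neg (by omega), a₁ b hb]
      iterate 4 simpa [Store.v_setV]
      · intro i' hi' j' hj hj' h
        exact a₇ i' hi' j' hj hj' (by omega)
  · rintro i τ ⟨hv4, hi, a₁, a₂, a₃, a₄, a₅, a₆, a₇⟩ hc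
    rw [holds_lt] at hc
    simp only [eval_var, hv4, a₁ 3 (by norm_num)] at hc
    refine hQ τ a₁ a₂ a₃ a₄ a₅ fun i' hi' j' hj hj' => ?_
    rw [← a₆]
    exact a₇ i' hi' j' hj hj' (by omega)

theorem Runs.rotate (h : σ.v 6 < σ.v 7) (hN : σ.v 7 ≤ N)
    (hQ : ∀ τ, (∀ b < 8, τ.v b = σ.v b) → (∀ c < 4, ∀ k, τ.pt d c k = σ.pt d c k) →
      τ.pt d 5 1 = σ.pt d 5 1 →
      (∀ q, τ.pt d 4 q = if q ≤ σ.v 6 then σ.pt d 4 q else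
        if q = σ.v 6 + 1 then σ.pt d 4 (σ.v 7) else
        if q ≤ σ.v 7 then σ.pt d 4 (q - 1) else σ.pt d 4 q) → Q τ) : Runs N (rotate d) σ Q := by
  refine .seq (.copyPt d (.seq (.assign (.seq ?_))))
  simp only [eval_var, eval_const, Store.v_setPt]
  -- `var 8` is the hole. It travels downwards, so each cell is copied before it is overwritten; the
  -- moved point waits in cell `0` of array `5`.
  refine .loop (fun a τ => τ.v 8 + a = σ.v 7 ∧ σ.v 6 < τ.v 8 ∧ (∀ b < 8, τ.v b = σ.v b) ∧
    (∀ c < 4, ∀ k, τ.pt d c k = σ.pt d c k) ∧ τ.pt d 5 1 = σ.pt d 5 1 ∧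
    τ.pt d 5 0 = σ.pt d 4 (σ.v 7) ∧
    (∀ q < τ.v 8, τ.pt d 4 q = σ.pt d 4 q) ∧
    (∀ q, τ.v 8 < q → q ≤ σ.v 7 → τ.pt d 4 q = σ.pt d 4 (q - 1)) ∧
    ∀ q, σ.v 7 < q → τ.pt d 4 q = σ.pt d 4 q) ?_ ?_ ?_
  · refine ⟨by simp [Store.v_setV], by simpa [Store.v_setV], ?_, ?_, ?_, ?_, ?_, ?_, ?_⟩
    · intro b hb; rw [Store.v_setV, if_neg (by omega), Store.v_setPt]
    · intro c hc k; rw [Store.pt_setV, Store.pt_setPt, if_neg (by omega)]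
    · simp [Store.pt_setPt]
    · simp [Store.pt_setPt]
    · simp [Store.pt_setPt]
    · intro q hq hq'
      simp only [Store.v_setV, if_true] at hq
      omega
    · simp [Store.pt_setPt]
  · rintro a τ ⟨h8, h6, hv, hp, hs, hx, hlow, hmid, hhigh⟩ hc
    rw [holds_lt] at hc
    simp only [eval_var, eval_add, eval_const, hv 6 (by norm_num)] at hc
    refine ⟨by omega, .seq (.copyPt d (.assign ?_))⟩
    simp only [eval_var, eval_sub, eval_const, Store.v_setPt]
    refine ⟨?_, ?_, ?_, ?_, ?_, ?_, ?_, ?_, ?_⟩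
    · simp only [Store.v_setV, if_true]; omega
    · simp only [Store.v_setV, if_true]; omega
    · intro b hb; rw [Store.v_setV, if_neg (by omega), Store.v_setPt, hv b hb]
    · intro c hc k; rw [Store.pt_setV, Store.pt_setPt, if_neg (by omega), hp c hc]
    · simp [Store.pt_setPt, hs]
    · simp [Store.pt_setPt, hx]
    · intro q hq
      simp only [Store.v_setV, if_true] at hq
      rw [Store.pt_setV, Store.pt_setPt, if_neg (by omega), hlow q (by omega)]
    · intro q hq hq'
      simp only [Store.v_setV, if_true] at hq
      rw [Store.pt_setV, Store.pt_setPt]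
      split_ifs with h
      · rw [h.2]; exact hlow _ (by omega)
      · exact hmid q (by omega) hq'
    · intro q hq
      rw [Store.pt_setV, Store.pt_setPt, if_neg (by omega), hhigh q hq]
  · rintro a τ ⟨h8, h6, hv, hp, hs, hx, hlow, hmid, hhigh⟩ hc
    rw [holds_lt] at hc
    simp only [eval_var, eval_add, eval_const, hv 6 (by norm_num)] at hc
    have h8' : τ.v 8 = σ.v 6 + 1 := by omega
    refine .copyPt d (hQ _ (by simpa using hv) ?_ ?_ ?_)
    · intro c hc k; rw [Store.pt_setPt, if_neg (by omega), hp c hc]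
    · simp [Store.pt_setPt, hs]
    · intro q
      simp only [eval_var, eval_const, Store.pt_setPt, h8', true_and, hx]
      by_cases h₁ : q ≤ σ.v 6
      · rw [if_neg (by omega), if_pos h₁, hlow q (by omega)]
      · rw [if_neg h₁]
        by_cases h₂ : q = σ.v 6 + 1
        · rw [if_pos h₂, if_pos h₂]
        · rw [if_neg h₂, if_neg h₂]
          by_cases h₃ : q ≤ σ.v 7
          · rw [if_pos h₃, hmid q (by omega) h₃]
          · rw [if_neg h₃, hhigh q (by omega)]

/-- Rotating part of an array: which points it holds. -/
theorem image_rotate {X Y : ℕ → Pt d} {i j : ℕ} (hij : i < j)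
    (hY : ∀ q, Y q = if q ≤ i then X q else if q = i + 1 then X j else
      if q ≤ j then X (q - 1) else X q) {k : ℕ} (hik : i < k) (hkj : k ≤ j) :
    Y '' Set.Iio (k + 1) = insert (X j) (X '' Set.Iio k) ∧
      ∀ m, j < m → Y '' Set.Iio m = X '' Set.Iio m := by
  constructor
  · ext x
    simp only [Set.mem_image, Set.mem_Iio, Set.mem_insert_iff]
    constructor
    · rintro ⟨q, hq, rfl⟩
      rw [hY]
      split_ifs with h₁ h₂ h₃
      · exact Or.inr ⟨q, by omega, rfl⟩
      · exact Or.inl rfl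
      · exact Or.inr ⟨q - 1, by omega, rfl⟩
      · omega
    · rintro (rfl | ⟨q, hq, rfl⟩)
      · exact ⟨i + 1, by omega, by rw [hY, if_neg (by omega), if_pos rfl]⟩
      · by_cases h₁ : q ≤ i
        · exact ⟨q, by omega, by rw [hY, if_pos h₁]⟩
        · exact ⟨q + 1, by omega, by
            rw [hY, if_neg (by omega), if_neg (by omega), if_pos (by omega), Nat.add_sub_cancel]⟩
  · intro m hm
    ext x
    simp only [Set.mem_image, Set.mem_Iio]
    constructor
    · rintro ⟨q, hq, rfl⟩
      rw [hY]
      split_ifs with h₁ h₂ h₃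
      · exact ⟨q, by omega, rfl⟩
      · exact ⟨j, by omega, rfl⟩
      · exact ⟨q - 1, by omega, rfl⟩
      · exact ⟨q, by omega, rfl⟩
    · rintro ⟨q, hq, rfl⟩
      by_cases h₁ : q ≤ i
      · exact ⟨q, by omega, by rw [hY, if_pos h₁]⟩
      by_cases h₂ : q = j
      · exact ⟨i + 1, by omega, by rw [hY, if_neg (by omega), if_pos rfl, h₂]⟩
      by_cases h₃ : q < j
      · exact ⟨q + 1, by omega, by
          rw [hY, if_neg (by omega), if_neg (by omega), if_pos (by omega), Nat.add_sub_cancel]⟩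
      · exact ⟨q, by omega, by rw [hY, if_neg h₁, if_neg (by omega), if_neg (by omega)]⟩

/-- After sorting, the path through the points is at most twice as long as a minimum spanning
tree. -/
theorem Runs.order {s : Pt d} {D : Set (Pt d)} (hpos : 0 < σ.v 2) (hN : σ.v 2 ≤ N)
    (hroot : σ.pt d 4 0 = s) (hD : σ.pt d 4 '' Set.Iio (σ.v 2) = D)
    (hQ : ∀ τ, τ.v 2 = σ.v 2 → out d τ = out d σ → τ.pt d 5 1 = σ.pt d 5 1 → τ.pt d 4 0 = s →
      τ.pt d 4 '' Set.Iio (σ.v 2) = D →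
      (∀ w, Span D {s} w → pathLength (arr (τ.pt d 4) (σ.v 2)) ≤ 2 * w) → Q τ) :
    Runs N (order d) σ Q := by
  refine .seq (.assign ?_)
  -- Amortization: any spanning set of length `w` can be thinned to one that connects to the ordered
  -- points, having given up at least half the length of the current path.
  refine .loop (fun a τ => τ.v 3 = a + 1 ∧ a < σ.v 2 ∧ τ.v 2 = σ.v 2 ∧ out d τ = out d σ ∧
    τ.pt d 5 1 = σ.pt d 5 1 ∧ τ.pt d 4 0 = s ∧ τ.pt d 4 '' Set.Iio (σ.v 2) = D ∧
    ∀ w, Span D {s} w → Span D (τ.pt d 4 '' Set.Iio (a + 1))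
      (w - pathLength (arr (τ.pt d 4) (a + 1)) / 2)) ?_ ?_ ?_
  · refine ⟨by simp [Store.v_setV], hpos, by simp [Store.v_setV],
      out_congr (by simp [Store.v_setV]) (by simp) (by simp), rfl, hroot, hD, ?_⟩
    intro w hw
    have h₁ : (σ.setV 3 (NExpr.eval σ (.const 1))).pt d 4 '' Set.Iio (0 + 1) = {s} := by
      simp [hroot]
    rw [h₁]
    simpa [arr, pathLength] using hw
  · rintro a τ ⟨h3, ha, h2, hout, hs, h0, himg, hspan⟩ hc
    rw [holds_lt] at hc
    simp only [eval_var, h3, h2] at hc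
    refine ⟨by omega, .seq (.search (by omega) (by omega) (by omega) ?_)⟩
    intro υ hv hp h6 h7 h7' hmin
    refine .seq (.rotate (by omega) (by omega) ?_)
    intro φ gv gp gs gY
    refine .assign ?_
    set i := υ.v 6
    set j := υ.v 7
    rw [h3] at h6 h7 hmin
    rw [h2] at h7' hmin
    simp only [hp 4 (by norm_num)] at gY
    obtain ⟨himg₁, himg₂⟩ := image_rotate (by omega) gY (k := a + 1) h6 h7
    refine ⟨?_, hc, ?_, ?_, ?_, ?_, ?_, ?_⟩
    · simp [Store.v_setV, gv 3 (by norm_num), hv 3 (by norm_num), h3]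
    · simp [Store.v_setV, gv 2 (by norm_num), hv 2 (by norm_num), h2]
    · rw [← hout]
      refine out_congr ?_ (fun k => ?_) (fun k => ?_)
      · simp [Store.v_setV, gv 1 (by norm_num), hv 1 (by norm_num)]
      · rw [Store.pt_setV, gp 2 (by norm_num), hp 2 (by norm_num)]
      · rw [Store.pt_setV, gp 3 (by norm_num), hp 3 (by norm_num)]
    · rw [Store.pt_setV, gs, hp 5 (by norm_num), hs]
    · rw [Store.pt_setV, gY, if_pos (by omega), h0]
    · exact (himg₂ _ h7').trans himg
    · intro w hw
      have key := (hspan w hw).insert (j := τ.pt d 4 j)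
        (δ := manhattanDist (τ.pt d 4 i) (τ.pt d 4 j)) (by rw [← himg]; exact ⟨j, h7', rfl⟩) (by
          rintro _ ⟨q, hq, rfl⟩ b hb hbT
          rw [← himg] at hb
          obtain ⟨q', hq', rfl⟩ := hb
          rcases hbT with hbT | hbT
          -- A value outside `T` must sit at an index beyond `a`, where the search has compared it.
          · refine hmin q hq q' ?_ hq'
            by_contra hlt
            exact hbT ⟨q', by simp only [Set.mem_Iio]; omega, rfl⟩
          · rw [hbT]; exact hmin q hq j h7 h7')
      rw [← himg₁] at key
      obtain ⟨E, e₁, e₂, e₃⟩ := key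
      refine ⟨E, e₁, e₂, e₃.trans ?_⟩
      -- The insertion lengthens the path by at most `2 * δ`, while the exchange has removed `δ`.
      have hins := pathLength_arr_insert_le (X := τ.pt d 4) (Y := φ.pt d 4) (i := i) (k := a + 1)
        (x := τ.pt d 4 j) h6 (fun q hq => by rw [gY, if_pos hq])
        (by rw [gY, if_neg (by omega), if_pos rfl])
        (fun q hq hq' => by
          rw [gY, if_neg (by omega), if_neg (by omega), if_pos (by omega), Nat.add_sub_cancel])
      have : (φ.setV 3 (NExpr.eval φ (.add (var 3) (.const 1)))).pt d 4 = φ.pt d 4 := rfl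
      rw [this]
      linarith
  · rintro a τ ⟨h3, ha, h2, hout, hs, h0, himg, hspan⟩ hc
    rw [holds_lt] at hc
    simp only [eval_var, h3, h2] at hc
    obtain ha : a + 1 = σ.v 2 := by omega
    refine hQ τ h2 hout hs h0 himg fun w hw => ?_
    -- What remains of the spanning set has nonnegative length, so half the path is at most `w`.
    have := (hspan w hw).nonneg
    rw [ha] at this
    linarith

end Ordering


section Loading

variable (d : ℕ)

/-! ### Reading the input -/

/-- Compute a common point of all bounding boxes and collect all points in array `4`. -/
def collect : Program :=
  .seq (initSep d) <|
  .seq (assign 3 (.const 0)) <|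
  .seq (.loop (lt (var 3) (var 0)) <|
    .seq (updateSep d (var 3)) <|
    .seq (copyPt d 4 (.add (var 3) (.const 1)) 0 (var 3)) <|
    .seq (copyPt d 4 (.add (.add (var 0) (var 3)) (.const 1)) 1 (var 3))
      (assign 3 (.add (var 3) (.const 1)))) <|
  .seq (copyPt d 4 (.const 0) 5 (.const 1))
    (assign 2 (.add (.add (var 0) (var 0)) (.const 1)))

/-- Write every point as a degenerate segment. -/
def emitPoints : Program :=
  .loop (lt (var 1) (var 2)) <|
    .seq (copyPt d 2 (var 1) 4 (var 1)) <|
    .seq (copyPt d 3 (var 1) 4 (var 1))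
      (assign 1 (.add (var 1) (.const 1)))

/-- The approximation algorithm. -/
def algorithm : Program :=
  .seq (collect d) <| .seq (emitPoints d) <| .seq (order d) (mergeAll d)

variable {d} {N : ℕ} {σ : Store} {Q : Store → Prop}

theorem pt_encodeInput (R : Instance d) (k : ℕ) (hk : k < R.length) :
    (encodeInput R).pt d 0 k = R[k].1 ∧ (encodeInput R).pt d 1 k = R[k].2 := by
  constructor
  · ext i; simp [Store.pt, encodeInput, hk]
  · ext i; simp [Store.pt, encodeInput, hk]

/-- The computed point is the coordinatewise maximum of the lower corners of the boxes: it dominates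
every lower corner and is at most any given common point, hence is a common point itself. -/
theorem Runs.collect {R : Instance d} (hR : IsSeparated d R) (hN : R.length ≤ N)
    (hQ : ∀ τ, τ.v 1 = 0 → τ.v 2 = 2 * R.length + 1 → Separates R (τ.pt d 5 1) →
      τ.pt d 4 0 = τ.pt d 5 1 →
      τ.pt d 4 '' Set.Iio (2 * R.length + 1) = terminals R (τ.pt d 5 1) → Q τ) :
    Runs N (collect d) (encodeInput R) Q := by
  set σ := encodeInput R with hσ
  set n := R.length with hn
  have hv0 : σ.v 0 = n := by simp [hσ, Store.v, encodeInput, hn]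
  have hv1 : σ.v 1 = 0 := by simp [hσ, Store.v, encodeInput]
  obtain ⟨s, hs⟩ := hR
  have hs' : ∀ k (hk : k < n) i, min (σ.pt d 0 k i) (σ.pt d 1 k i) ≤ s i := by
    intro k hk i
    have := hs R[k] (List.getElem_mem hk) i i.2
    rw [(pt_encodeInput R k hk).1, (pt_encodeInput R k hk).2, min_le_iff]
    tauto
  refine .seq (.initSep d (.seq (.assign (.seq ?_))))
  simp only [eval_const]
  -- The upper bound is claimed only for `0 < n`: without pairs, the point is initialized from zero
  -- cells, and every point separates.
  refine .loop (fun k τ => τ.v 0 = n ∧ τ.v 1 = 0 ∧ τ.v 3 = k ∧ k ≤ n ∧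
    (∀ c < 2, ∀ a, τ.pt d c a = σ.pt d c a) ∧
    (∀ a < k, τ.pt d 4 (a + 1) = σ.pt d 0 a ∧ τ.pt d 4 (n + a + 1) = σ.pt d 1 a) ∧
    (∀ a < k, ∀ i, min (σ.pt d 0 a i) (σ.pt d 1 a i) ≤ τ.pt d 5 1 i) ∧
    (0 < n → ∀ i, τ.pt d 5 1 i ≤ s i)) ?_ ?_ ?_
  · refine ⟨by simp [Store.v_setV, hv0], by simp [Store.v_setV, hv1], by simp [Store.v_setV],
      by simp, ?_, by simp, by simp, ?_⟩
    · intro c hc a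
      rw [Store.pt_setV, Store.pt_setPt, if_neg (by omega)]
    · intro h0 i
      simpa [Store.pt_setPt] using hs' 0 h0 i
  · rintro k τ ⟨h0, h1, h3, hk, hin, hpts, hlow, hup⟩ hc
    rw [holds_lt] at hc
    simp only [eval_var, h0, h3] at hc
    refine ⟨by omega, .seq (.updateSep d (.seq (.copyPt d (.seq (.copyPt d (.assign ?_))))))⟩
    simp only [eval_var, eval_add, eval_const, Store.v_setPt, h0, h3, Store.pt_setPt,
      hin 0 (by norm_num), hin 1 (by norm_num)]
    refine ⟨by simp [Store.v_setV, h0], by simp [Store.v_setV, h1], by simp [Store.v_setV],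
      hc, ?_, ?_, ?_, ?_⟩
    · intro c hc a
      simp only [Store.pt_setV, Store.pt_setPt]
      rw [if_neg (by omega), if_neg (by omega), if_neg (by omega), hin c hc]
    · intro a ha
      simp only [Store.pt_setV, Store.pt_setPt]
      by_cases hak : a = k
      · subst hak
        simp only [true_and, add_left_inj]
        refine ⟨?_, ?_⟩
        · rw [if_neg (by omega)]; simp
        · simp
      · rw [if_neg (by omega), if_neg (by omega), if_neg (by omega), if_neg (by omega),
          if_neg (by omega), if_neg (by omega)]
        exact hpts a (by omega)
    · intro a ha i
      simp only [Store.pt_setV, Store.pt_setPt]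
      rw [if_neg (by omega), if_neg (by omega), if_pos (by simp), le_max_iff]
      by_cases hak : a = k
      · subst hak; exact Or.inr le_rfl
      · exact Or.inl (hlow a (by omega) i)
    · intro hpos i
      simp only [Store.pt_setV, Store.pt_setPt]
      rw [if_neg (by omega), if_neg (by omega), if_pos (by simp)]
      exact max_le (hup hpos i) (hs' k hc i)
  · rintro k τ ⟨h0, h1, h3, hk, hin, hpts, hlow, hup⟩ hc
    rw [holds_lt] at hc
    simp only [eval_var, h0, h3] at hc
    obtain rfl : k = n := by omega
    refine .seq (.copyPt d (.assign ?_))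
    simp only [eval_var, eval_add, eval_const, Store.v_setPt, h0]
    generalize hυ : Store.setV _ 2 _ = υ
    have h5 : υ.pt d 5 1 = τ.pt d 5 1 := by subst hυ; simp [Store.pt_setPt]
    have h4 : υ.pt d 4 0 = τ.pt d 5 1 := by subst hυ; simp [Store.pt_setPt]
    have h4' : ∀ a < n, υ.pt d 4 (a + 1) = σ.pt d 0 a ∧ υ.pt d 4 (n + a + 1) = σ.pt d 1 a := by
      intro a ha; subst hυ; simpa [Store.pt_setPt] using hpts a ha
    refine hQ υ ?_ ?_ ?_ ?_ ?_
    · subst hυ; simp [Store.v_setV, h1]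
    · subst hυ; simp [Store.v_setV]; omega
    · rw [h5]
      intro r hr i
      obtain ⟨k, hk, rfl⟩ := List.mem_iff_getElem.1 hr
      have e := hlow k hk i
      rw [(pt_encodeInput R k hk).1, (pt_encodeInput R k hk).2, min_le_iff] at e
      have e' := hup (by omega) i
      have e'' := hs R[k] hr i i.2
      grind
    · rw [h4, h5]
    · ext x
      rw [h5]
      simp only [Set.mem_image, Set.mem_Iio, terminals, Set.mem_ofPred_eq]
      constructor
      · rintro ⟨q, hq, rfl⟩
        by_cases hq0 : q = 0
        · subst hq0; exact Or.inl h4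
        · by_cases hqn : q ≤ n
          · have hlt : q - 1 < n := by omega
            refine Or.inr ⟨R[q - 1], List.getElem_mem hlt, Or.inl ?_⟩
            rw [← (pt_encodeInput R (q - 1) hlt).1, ← (h4' (q - 1) hlt).1]
            congr 1; omega
          · have hlt : q - n - 1 < n := by omega
            refine Or.inr ⟨R[q - n - 1], List.getElem_mem hlt, Or.inr ?_⟩
            rw [← (pt_encodeInput R (q - n - 1) hlt).2, ← (h4' (q - n - 1) hlt).2]
            congr 1; omega
      · rintro (rfl | ⟨r, hr, hx⟩)
        · exact ⟨0, by omega, h4⟩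
        · obtain ⟨k, hk, rfl⟩ := List.mem_iff_getElem.1 hr
          rcases hx with rfl | rfl
          · exact ⟨k + 1, by omega, by rw [(h4' k hk).1, (pt_encodeInput R k hk).1]⟩
          · exact ⟨n + k + 1, by omega, by rw [(h4' k hk).2, (pt_encodeInput R k hk).2]⟩

/-- Zero-length segments put every point on the network for free, which supplies the trivial paths
from which merging starts. -/
theorem Runs.emitPoints (h1 : σ.v 1 = 0) (hN : σ.v 2 ≤ N)
    (hQ : ∀ τ, τ.v 2 = σ.v 2 → τ.pt d 5 1 = σ.pt d 5 1 → τ.pt d 4 = σ.pt d 4 →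
      IsRectilinear (out d τ) → networkLength (out d τ) = 0 →
      (∀ i < σ.v 2, σ.pt d 4 i ∈ support (out d τ)) → Q τ) :
    Runs N (emitPoints d) σ Q := by
  refine .loop (fun k τ => τ.v 1 = k ∧ k ≤ σ.v 2 ∧ τ.v 2 = σ.v 2 ∧ τ.pt d 5 1 = σ.pt d 5 1 ∧
    τ.pt d 4 = σ.pt d 4 ∧ IsRectilinear (out d τ) ∧ networkLength (out d τ) = 0 ∧
    ∀ i < k, σ.pt d 4 i ∈ support (out d τ)) ?_ ?_ ?_
  · have : out d σ = [] := by simp [out, h1]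
    simp [h1, this, IsRectilinear, networkLength]
  · rintro k τ ⟨h1, hk, h2, h5, h4, hrect, hlen, hmem⟩ hc
    rw [holds_lt] at hc
    simp only [eval_var, h1, h2] at hc
    refine ⟨by omega, .seq (.copyPt d (.seq (.copyPt d (.assign ?_))))⟩
    simp only [eval_var, eval_add, eval_const, Store.v_setPt, h1]
    generalize hυ : Store.setV _ 1 _ = υ
    have hout : out d υ = out d τ ++ [(σ.pt d 4 k, σ.pt d 4 k)] := by
      subst hυ
      refine out_succ ?_ ?_ ?_
      · simp [Store.v_setV, h1]
      · intro a; simp [Store.pt_setPt, h1, h4]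
      · intro a; simp [Store.pt_setPt, h1, h4]
    refine ⟨?_, hc, ?_, ?_, ?_, ?_, ?_, ?_⟩
    · subst hυ; simp [Store.v_setV]
    · subst hυ; simp [Store.v_setV, h2]
    · subst hυ; simp [Store.pt_setPt, h5]
    · ext1 a; subst hυ; simp [Store.pt_setPt, h4]
    · rw [hout]
      intro e he
      rcases List.mem_append.1 he with he | he
      · exact hrect e he
      · simp at he; subst he; exact .refl _
    · rw [hout, networkLength_append, hlen]; simp [networkLength]
    · intro i hi
      rw [hout, support_append]
      by_cases hik : i = k
      · subst hik; exact Or.inr ⟨_, List.mem_singleton_self _, left_mem_segment ℝ _ _⟩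
      · exact Or.inl (hmem i (by omega))
  · rintro k τ ⟨h1, hk, h2, h5, h4, hrect, hlen, hmem⟩ hc
    rw [holds_lt] at hc
    simp only [eval_var, h1, h2] at hc
    obtain rfl : k = σ.v 2 := by omega
    exact hQ τ h2 h5 h4 hrect hlen hmem

/-! ### Feasibility and the approximation ratio -/

theorem btw_of_separates {R : Instance d} {s : Pt d} (h : Separates R s) {r : Pt d × Pt d}
    (hr : r ∈ R) : Btw r.1 s r.2 := by
  refine btw_of_coord fun i => ?_
  have := h r hr i
  grind

/-- In the constant `4 * 2 ^ d`, one factor `2` comes from doubling segments to a walk, the other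
from the insertion path, and `2 ^ d` from the projections. -/
theorem runs_algorithm {R : Instance d} (hR : IsSeparated d R) :
    Runs (2 * R.length + 1) (algorithm d) (encodeInput R) fun τ => IsFeasible R (out d τ) ∧
      ∀ M : Network d, IsFeasible R M → networkLength (out d τ) ≤
        4 * 2 ^ d * Nat.clog 2 (2 * R.length + 1) * networkLength M := by
  refine .seq (.collect hR (by omega) ?_)
  intro τ₁ h1 h2 hsep h0 himg
  set s := τ₁.pt d 5 1 with hs
  refine .seq (.emitPoints h1 h2.le ?_)
  intro τ₂ g2 g5 g4 hrect hlen hmem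
  rw [h2] at g2
  refine .seq (.order (s := s) (D := terminals R s) (by omega) (by omega) (by rw [g4, h0])
    (by rw [g2, g4, himg]) ?_)
  intro τ₃ k2 kout k5 k0 kimg kspan
  rw [g2] at k2 kimg kspan
  have hmem' : ∀ x ∈ terminals R s, x ∈ support (out d τ₃) := by
    rw [kout, ← himg]
    rintro _ ⟨i, hi, rfl⟩
    exact hmem i (by rw [h2]; exact hi)
  refine .mergeAll (s := s) (D := terminals R s)
    ⟨k5.trans g5, k0, by omega, ?_, ?_, by rwa [kout]⟩ k2.le ?_
  · intro i hi
    refine hmem' _ ?_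
    rw [← kimg]
    exact ⟨i, by rwa [k2] at hi, rfl⟩
  · intro p hp
    have hp' := hp
    rw [← kimg] at hp'
    obtain ⟨i, hi, rfl⟩ := hp'
    exact ⟨i, by rw [k2]; exact hi, mconnects_self (hmem' _ hp), .refl _ _⟩
  · intro τ hrect' hconn hcost
    refine ⟨⟨hrect', fun r hr => ?_⟩, fun M hM => ?_⟩
    · exact (hconn r.1 (Or.inr ⟨r, hr, Or.inl rfl⟩)).trans
        (hconn r.2 (Or.inr ⟨r, hr, Or.inr rfl⟩)).symm (btw_of_separates hsep hr)
    · rw [kout, hlen, k2, zero_add] at hcost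
      refine hcost.trans ?_
      have := kspan _ (span_of_isFeasible hsep hM)
      calc (Nat.clog 2 (2 * R.length + 1) : ℝ) * pathLength (arr (τ₃.pt d 4) (2 * R.length + 1))
          ≤ Nat.clog 2 (2 * R.length + 1) * (2 * (2 * (2 ^ d * networkLength M))) :=
            mul_le_mul_of_nonneg_left this (Nat.cast_nonneg _)
        _ = _ := by ring

theorem isBigO_clog (C : ℝ) :
    (fun n : ℕ => C * (Nat.clog 2 (2 * n + 1) : ℝ)) =O[Filter.atTop]
      fun n : ℕ => Real.log (n : ℝ) := by
  -- For `n ≥ 2`, `clog 2 (2 * n + 1) ≤ log₂ n + 2 ≤ 3 * log₂ n`, so `4 / log 2` leaves room.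
  refine Asymptotics.IsBigO.const_mul_left (.of_bound (4 / Real.log 2) ?_) C
  filter_upwards [Filter.eventually_ge_atTop 2] with n hn
  have hlog2 : 0 < Real.log 2 := Real.log_pos (by norm_num)
  have hle : Real.log 2 ≤ Real.log n := Real.log_le_log (by norm_num) (by exact_mod_cast hn)
  have h₁ : Nat.clog 2 (2 * n + 1) ≤ Nat.log 2 n + 2 := by
    refine Nat.clog_le_of_le_pow ?_
    have := Nat.lt_pow_succ_log_self (b := 2) (by norm_num) n
    rw [Nat.succ_eq_add_one, pow_succ] at this
    rw [pow_add]
    omega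
  have h₂ : (Nat.log 2 n : ℝ) * Real.log 2 ≤ Real.log n := by
    rw [← Real.log_pow]
    refine Real.log_le_log (by positivity) ?_
    exact_mod_cast Nat.pow_log_le_self 2 (by omega)
  have h₃ : (Nat.clog 2 (2 * n + 1) : ℝ) ≤ Nat.log 2 n + 2 := by exact_mod_cast h₁
  rw [Real.norm_of_nonneg (Nat.cast_nonneg _), Real.norm_of_nonneg (by linarith), div_mul_eq_mul_div,
    le_div_iff₀ hlog2]
  nlinarith

end Loading

end GMMN

theorem mainTheorem6 (d : ℕ) :
    ∃ ρ : ℕ → ℝ, (ρ =O[Filter.atTop] fun n : ℕ => Real.log (n : ℝ)) ∧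
      GMMN.AdmitsApproximation d d ρ := by
  refine ⟨fun n => 4 * 2 ^ d * Nat.clog 2 (2 * n + 1), GMMN.isBigO_clog _, GMMN.algorithm d,
    -- The bound is in terms of loop repetitions, and there are `2 * n + 1` points.
    (GMMN.algorithm d).bound.comp (2 * Polynomial.X + 1), fun R hR => ?_⟩
  obtain ⟨σ, t, h₁, h₂, h₃, h₄⟩ := GMMN.runs_algorithm hR
  refine ⟨σ, t, h₁, by simpa [Polynomial.eval_comp] using h₂, ?_⟩
  rw [GMMN.decodeOutput_eq_out]
  exact ⟨h₃, h₄⟩
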